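/- Let $G$ be a connected complex Lie group whose Lie algebra $\mathfrak g$ is simple. Fix a Cartan subalgebra $\mathfrak h\subset\mathfrak g$, simple roots $\alpha_1,\dots,\alpha_n$ of the root system $\Delta$ of $(\mathfrak g,\mathfrak h)$ with positive roots $\Delta^+$, and a Chevalley basis $\{e_\alpha\in\mathfrak g_\alpha\ (\alpha\in\Delta);\ h_{\alpha_i}\ (1\le i\le n)\}$. Let $N_-\subset G$ be the connected Lie subgroup with Lie algebra $\mathfrak n_-=\bigoplus_{\alpha\in\Delta^+}\mathfrak g_{-\alpha}$, that is, the subgroup generated by $\exp\mathfrak n_-$. Let $E_1,\dots,E_n\in\mathfrak h$ be the elements with $\alpha_i(E_j)=\delta_{ij}$. Let $\gamma_1,\dots,\gamma_n\in\mathbb R$ with $\gamma_i>-1$, and put $\mu_i=\gamma_i+1$ and $w_0=\sum_{i=1}^n\mu_iE_i$, so that $\alpha_i(w_0)=\mu_i$. For $z\in\mathbb C\setminus\mathbb R_{\le 0}$ put, with the principal branches of $\log$ and of the powers, $$\zeta(z)=\sum_{i=1}^n z^{\gamma_i}e_{-\alpha_i},\qquad \xi(z)=z\zeta(z)=\sum_{i=1}^n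 z^{\mu_i}e_{-\alpha_i},\qquad Q(z)=\exp\Big(\sum_{j=1}^n \mu_j\log z\; E_j\Big),$$ and put $f=\sum_{i=1}^n e_{-\alpha_i}$. Then there is a unique map $\Psi:\mathbb C\setminus\mathbb R_{\le0}\to N_-$ such that $$\operatorname{Ad}_{\Psi(z)^{-1}}w_0=w_0-\xi(z)\qquad\text{for all } z\in\mathbb C\setminus\mathbb R_{\le 0};$$ there is a unique holomorphic map $\Phi:\mathbb C\setminus\mathbb R_{\le0}\to N_-$ such that $$\Phi^{-1}\Phi_z=\zeta\ \text{ on }\mathbb C\setminus\mathbb R_{\le 0},\qquad \lim_{z\to0}\Phi(z)=\mathrm{Id};$$ and $\Psi=\Phi$. Moreover, there is a unique $\psi\in N_-$ with $\operatorname{Ad}_{\psi^{-1}}w_0=w_0-f$, and $$\Psi(z)=\Phi(z)=Q(z)^{-1}\,\psi\,Q(z)\qquad\text{for all } z\in\mathbb C\setminus\mathbb R_{\le 0}.$$ -/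

import Mathlib

open scoped Manifold ContDiff Topology

noncomputable section

namespace TodaLie

section GroupPart

variable {E : Type*} [NormedAddCommGroup E] [NormedSpace ℂ E]
  (G : Type*) [TopologicalSpace G] [ChartedSpace E G] [Group G]

/-- The complex Lie algebra `𝔤` of a complex Lie group `G`: the tangent space at the identity, with
the bracket of left-invariant vector fields. -/
abbrev LieAlg : Type _ := GroupLieAlgebra 𝓘(ℂ, E) G

variable {G}

instance [FiniteDimensional ℂ E] : FiniteDimensional ℂ (LieAlg (E := E) G) :=
  inferInstanceAs (FiniteDimensional ℂ E)

/-- The adjoint action `Ad_g`: the differential at the identity of `x ↦ g x g⁻¹`. -/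
def Ad (g : G) : LieAlg (E := E) G →L[ℂ] LieAlg (E := E) G :=
  mfderiv 𝓘(ℂ, E) 𝓘(ℂ, E) (fun x : G => g * x * g⁻¹) 1

/-- `F : ℂ → G` is complex differentiable at `z`, with `F⁻¹ F_z = X` at `z`. That is, the complex
derivative `F_z(z) ∈ T_{F(z)} G` is the left translate of `X ∈ 𝔤` by `F(z)`. -/
def HasLeftLogDerivAt (F : ℂ → G) (X : LieAlg (E := E) G) (z : ℂ) : Prop :=
  HasMFDerivAt 𝓘(ℂ, ℂ) 𝓘(ℂ, E) F z
    ((1 : ℂ →L[ℂ] ℂ).smulRight (mulInvariantVectorField X (F z)))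

/-- `φ` is the complex one-parameter subgroup of `G` generated by `X`: the integral curve
through the identity of the left-invariant vector field of `X`. -/
def IsOneParam (X : LieAlg (E := E) G) (φ : ℂ → G) : Prop :=
  φ 0 = 1 ∧ ∀ t : ℂ, HasLeftLogDerivAt φ X t

open Classical in
/-- The exponential map `exp : 𝔤 → G`: the time-one value of the one-parameter subgroup generated
by `X`, which exists and is unique on every finite-dimensional complex Lie group. -/
def lieExp (X : LieAlg (E := E) G) : G :=
  if h : ∃ φ : ℂ → G, IsOneParam X φ then h.choose 1 else 1

end GroupPart

section Chevalley

variable {L : Type*} [LieRing L] [LieAlgebra ℂ L] [FiniteDimensional ℂ L]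
  [LieAlgebra.IsKilling ℂ L] (H : LieSubalgebra ℂ L) [H.IsCartanSubalgebra]

variable {H} in
/-- The opposite `-α` of a root `α`. -/
def negRoot (α : H.root) : H.root := ⟨-α.1, by
  have h : α.1.IsNonZero := LieSubalgebra.isNonZero_coe_root α
  simpa using LieModule.Weight.IsNonZero.neg h⟩

/-- A Chevalley basis `{e_α, h_{α_i}}` of `L` with respect to the Cartan subalgebra `H`. The part in
`H` consists of the simple coroots and so is not recorded. -/
structure ChevalleyBasis where
  /-- the root vectors -/
  e : H.root → L
  e_mem (α : H.root) : e α ∈ LieAlgebra.rootSpace H α.1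
  lie_e_neg (α : H.root) :
    ⁅e α, e (negRoot α)⁆ = ((LieAlgebra.IsKilling.coroot α.1 : H) : L)
  lie_e_e (α β δ : H.root) (hδ : (δ.1 : H → ℂ) = (α.1 : H → ℂ) + (β.1 : H → ℂ)) :
    ∃ c : ℂ, ⁅e α, e β⁆ = c • e δ ∧ ⁅e (negRoot α), e (negRoot β)⁆ = -(c • e (negRoot δ))

variable {H}
variable (b : (LieAlgebra.IsKilling.rootSystem H).Base)

/-- `𝔫₋ = ⨁_{α > 0} 𝔤_{-α}`, for the positive system with simple roots `b`. -/
def nMinus : Submodule ℂ L :=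
  ⨆ (α : H.root) (_ : b.IsPos α), (LieAlgebra.rootSpace H (negRoot α).1).toSubmodule

open Classical in
/-- `E_j = ∑_k a^{kj} h_{α_k}`, where `(a^{ij})` is the inverse Cartan matrix. -/
def fundE (j : b.support) : H :=
  ∑ k : b.support, (b.cartanMatrixIn ℂ)⁻¹ k j • LieAlgebra.IsKilling.coroot k.1.1

open Classical in
/-- `α_i(E_j) = δ_{ij}`. -/
theorem root_fundE (i j : b.support) :
    i.1.1 (fundE b j) = if i = j then 1 else 0 := by
  have hdet : IsUnit (b.cartanMatrixIn ℂ).det := by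
    have := Matrix.nondegenerate_iff_det_ne_zero.mp (b.cartanMatrixIn_nondegenerate ℂ)
    exact this.isUnit
  have h := congrFun (congrFun (Matrix.mul_nonsing_inv _ hdet) i) j
  rw [Matrix.mul_apply, Matrix.one_apply] at h
  rw [← h]
  have hc (k : b.support) : b.cartanMatrixIn ℂ i k =
      LieModule.Weight.toLinear ℂ H L i.1.1 (LieAlgebra.IsKilling.coroot k.1.1) := by
    have := b.algebraMap_cartanMatrixIn_apply ℂ i k
    simpa using this
  simp only [hc]
  change LieModule.Weight.toLinear ℂ H L i.1.1 (fundE b j) = _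
  simp only [fundE, map_sum, map_smul, smul_eq_mul, mul_comm]

/-- `w₀ = ∑_j μ_j E_j` with `μ_j = γ_j + 1`. -/
def w₀ (γ : b.support → ℝ) : H := ∑ j, ((γ j + 1 : ℝ) : ℂ) • fundE b j

/-- `⟨α_i, w₀⟩ = μ_i`. -/
theorem root_w₀ (γ : b.support → ℝ) (i : b.support) :
    i.1.1 (w₀ b γ) = ((γ i + 1 : ℝ) : ℂ) := by
  classical
  change LieModule.Weight.toLinear ℂ H L i.1.1 (w₀ b γ) = _
  have h (j : b.support) :
      LieModule.Weight.toLinear ℂ H L i.1.1 (fundE b j) = if i = j then 1 else 0 := by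
    convert root_fundE b i j
    rfl
  simp only [w₀, map_sum, map_smul, h, smul_eq_mul]
  simp

variable (c : ChevalleyBasis H)

/-- `f = ∑_i e_{-α_i}`. -/
def principalF : L := ∑ i : b.support, c.e (negRoot i.1)

/-- `ζ(z) = ∑_i z^{γ_i} e_{-α_i}`, with the principal branch of the power. -/
def zeta (γ : b.support → ℝ) (z : ℂ) : L :=
  ∑ i : b.support, (z ^ ((γ i : ℝ) : ℂ)) • c.e (negRoot i.1)

/-- `ξ(z) = ∑_i z^{μ_i} e_{-α_i}` with `μ_i = γ_i + 1`. -/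
def xi (γ : b.support → ℝ) (z : ℂ) : L :=
  ∑ i : b.support, (z ^ ((γ i + 1 : ℝ) : ℂ)) • c.e (negRoot i.1)

end Chevalley

section Main

variable {E : Type*} [NormedAddCommGroup E] [NormedSpace ℂ E] [FiniteDimensional ℂ E]
  [CompleteSpace E]
  {G : Type*} [TopologicalSpace G] [ChartedSpace E G] [Group G] [LieGroup 𝓘(ℂ, E) ω G]
  [LieAlgebra.IsSimple ℂ (LieAlg (E := E) G)]
  {H : LieSubalgebra ℂ (LieAlg (E := E) G)} [H.IsCartanSubalgebra]
  (b : (LieAlgebra.IsKilling.rootSystem H).Base)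

/-- `N₋`, the connected Lie subgroup of `G` with Lie algebra `𝔫₋`: the subgroup generated by
`exp 𝔫₋`. -/
def NMinus : Subgroup G := Subgroup.closure (lieExp '' (nMinus b : Set (LieAlg (E := E) G)))

/-- `Q(z) = exp (∑_j log z^{μ_j} E_j)`, with `log z^{μ_j} = μ_j log z` for the principal branch. -/
def Q (γ : b.support → ℝ) (z : ℂ) : G :=
  lieExp (∑ j, (((γ j + 1 : ℝ) : ℂ) * Complex.log z) • (fundE b j : LieAlg (E := E) G))

variable (c : ChevalleyBasis H)

/-- `Ψ` maps `ℂ ∖ ℝ_{≤0}` to `N₋`, with `Ad_{Ψ⁻¹} w₀ = w₀ - ξ` there. -/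
def IsConjugator (γ : b.support → ℝ) (Ψ : ℂ → G) : Prop :=
  ∀ z ∈ Complex.slitPlane, Ψ z ∈ NMinus b ∧
    Ad (Ψ z)⁻¹ (w₀ b γ : LieAlg (E := E) G) = (w₀ b γ : LieAlg (E := E) G) - xi b c γ z

/-- `Φ` maps `ℂ ∖ ℝ_{≤0}` holomorphically to `N₋`, with `Φ⁻¹ Φ_z = ζ` there and
`Φ(z) → 1` as `z → 0`. -/
def IsTodaSolution (γ : b.support → ℝ) (Φ : ℂ → G) : Prop :=
  (∀ z ∈ Complex.slitPlane, Φ z ∈ NMinus b ∧ HasLeftLogDerivAt Φ (zeta b c γ z) z) ∧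
    Filter.Tendsto Φ (𝓝[Complex.slitPlane] 0) (𝓝 1)

end Main

end TodaLie

end

/-!
The proof rests on one computation. Write `a(t) = exp(t w₀)`, so that `Q(z) = a(log z)`. If
`ψ ∈ N₋` satisfies `Ad_{ψ⁻¹} w₀ = w₀ - f`, then `Φ = Q⁻¹ ψ Q` satisfies
`Ad_{Φ⁻¹} w₀ = Ad_{Q⁻¹} (w₀ - f) = w₀ - ξ`, because `Ad_{Q(z)⁻¹}` multiplies `e_{-α_i}` by `z ^ μ_i`;
and the product rule for left logarithmic derivatives gives
`Φ⁻¹ Φ_z = Ad_{Q⁻¹} (-(w₀ - f) / z) + w₀ / z = ξ / z = ζ` (`hasLeftLogDerivAt_conj_Q`).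

*Contraction.* For a positive root `α` the number `α(w₀)` is real and positive, so `Ad_{a(t)}` tends
to `0` on `𝔫₋` as `Re t → ∞`. Since `exp` is continuous at `0`, and `N₋` is generated by `exp 𝔫₋`, the
conjugate `a(t) g a(t)⁻¹` tends to `1` for every `g ∈ N₋` (`tendsto_conj_lieExp_w₀`). With
`t = -log z` this is the limit `Φ(z) → 1`. It also shows that the stabiliser of `w₀` in `N₋` is
trivial (`eq_one_of_Ad_w₀_eq`): an element of the stabiliser commutes with all `a(t)`, so it equals
its own limit `1`. This gives the uniqueness of `ψ` and `Ψ` without knowing that `exp` maps `𝔫₋` onto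
`N₋`.

*Existence of `ψ`.* `N₋` acts transitively on `w₀ + 𝔫₋` (`exists_Ad_w₀_add_eq`). Filter `𝔫₋` by the
values of the roots on `w₀`. As `ad w₀` is invertible on each step, an error `Y` in one step is
removed, modulo the next one, by `exp X` with `⁅w₀, X⁆ = Y`; the filtration is finite.

*Uniqueness of `Φ`.* The quotient of two solutions has zero derivative on the connected slit plane,
hence is constant, and the limit at `0` is `1` (`IsTodaSolution.eqOn`).

The theory of complex Lie groups needed for this is developed from the definition of the bracket by
left-invariant vector fields: the calculus of left logarithmic derivatives, the formula
`d(Ad)_1 = ad` (both sides are read off the second derivative of the multiplication in the chart at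
the identity), and the existence of complex one-parameter subgroups. The latter come from a
holomorphic Picard iteration whose estimates are linear in the generator, so that they also yield the
continuity of `exp` at `0`; a local solution is extended to `ℂ` by repeated squaring.
-/

open scoped Manifold ContDiff Topology

noncomputable section

namespace TodaLie

/-! ### Left logarithmic derivatives -/

section Calculus

variable {E : Type*} [NormedAddCommGroup E] [NormedSpace ℂ E]

theorem mfderiv_comp_apply_eq {N : Type*} [TopologicalSpace N] [ChartedSpace E N]
    {f g : N → N} {x y : N} (h : f x = y)
    (hg : MDifferentiableAt 𝓘(ℂ, E) 𝓘(ℂ, E) g y) (hf : MDifferentiableAt 𝓘(ℂ, E) 𝓘(ℂ, E) f x)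
    (v : TangentSpace 𝓘(ℂ, E) x) :
    mfderiv 𝓘(ℂ, E) 𝓘(ℂ, E) (g ∘ f) x v =
      mfderiv 𝓘(ℂ, E) 𝓘(ℂ, E) g y (mfderiv 𝓘(ℂ, E) 𝓘(ℂ, E) f x v : E) := by
  subst h
  rw [mfderiv_comp x hg hf]; rfl

variable {G : Type*} [TopologicalSpace G] [ChartedSpace E G] [Group G]

theorem mulInvariantVectorField_one (X : LieAlg (E := E) G) :
    mulInvariantVectorField X 1 = X := by
  have : (fun y : G => 1 * y) = id := by ext; simp
  simp only [mulInvariantVectorField]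
  rw [this, mfderiv_id]; rfl

theorem Ad_one : Ad (1 : G) = ContinuousLinearMap.id ℂ (LieAlg (E := E) G) := by
  have : (fun y : G => 1 * y * 1⁻¹) = id := by ext; simp
  rw [Ad, this, mfderiv_id]

theorem HasLeftLogDerivAt.congr {F K : ℂ → G} {X : LieAlg (E := E) G} {z : ℂ}
    (hF : HasLeftLogDerivAt F X z) (h : K =ᶠ[𝓝 z] F) : HasLeftLogDerivAt K X z := by
  have h1 := HasMFDerivAt.congr_of_eventuallyEq hF h
  unfold HasLeftLogDerivAt
  rw [h.eq_of_nhds]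
  exact h1

theorem HasLeftLogDerivAt.comp {F : ℂ → G} {X : LieAlg (E := E) G} {z : ℂ} {u : ℂ → ℂ} {u' : ℂ}
    (hF : HasLeftLogDerivAt F X (u z)) (hu : HasDerivAt u u' z) :
    HasLeftLogDerivAt (fun z => F (u z)) (u' • X) z := by
  have h1 := HasMFDerivAt.comp z hF hu.hasFDerivAt.hasMFDerivAt
  refine h1.congr_mfderiv ?_
  refine ContinuousLinearMap.ext fun (t : ℂ) => ?_
  have e3 := congrFun (mulInvariantVectorField_smul (I := 𝓘(ℂ, E)) (G := G) u' X) (F (u z))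
  calc _ = (t * u') • mulInvariantVectorField X (F (u z)) := rfl
    _ = t • mulInvariantVectorField (u' • X) (F (u z)) := by
      rw [e3, Pi.smul_apply, mul_smul]
    _ = _ := rfl

theorem hasLeftLogDerivAt_const (g : G) (z : ℂ) :
    HasLeftLogDerivAt (E := E) (fun _ => g) 0 z := by
  refine (hasMFDerivAt_const g z).congr_mfderiv ?_
  refine ContinuousLinearMap.ext fun (t : ℂ) => ?_
  have e1 : mulInvariantVectorField (0 : LieAlg (E := E) G) g = 0 :=
    map_zero (mfderiv 𝓘(ℂ, E) 𝓘(ℂ, E) (fun y : G => g * y) 1)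
  calc _ = (0 : TangentSpace 𝓘(ℂ, E) g) := rfl
    _ = t • mulInvariantVectorField (0 : LieAlg (E := E) G) g := by
      rw [e1, smul_zero]
    _ = _ := rfl

variable [LieGroup 𝓘(ℂ, E) ω G]

theorem mdifferentiableAt_mul_left (g x : G) :
    MDifferentiableAt 𝓘(ℂ, E) 𝓘(ℂ, E) (fun y : G => g * y) x :=
  (contMDiff_mul_left (I := 𝓘(ℂ, E)) (n := ω) (a := g)).contMDiffAt.mdifferentiableAt (by simp)

theorem mdifferentiableAt_mul_right (g x : G) :
    MDifferentiableAt 𝓘(ℂ, E) 𝓘(ℂ, E) (fun y : G => y * g) x :=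
  (contMDiff_mul_right (I := 𝓘(ℂ, E)) (n := ω) (a := g)).contMDiffAt.mdifferentiableAt (by simp)

theorem mdifferentiableAt_conj (g x : G) :
    MDifferentiableAt 𝓘(ℂ, E) 𝓘(ℂ, E) (fun y : G => g * y * g⁻¹) x :=
  (mdifferentiableAt_mul_right g⁻¹ (g * x)).comp x (mdifferentiableAt_mul_left g x)

theorem mfderiv_mul_left_mulInvariantVectorField (g h : G) (X : LieAlg (E := E) G) :
    mfderiv 𝓘(ℂ, E) 𝓘(ℂ, E) (fun y : G => g * y) h (mulInvariantVectorField X h) =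
      mulInvariantVectorField X (g * h) := by
  have h1 : (fun y : G => g * h * y) = (fun y => g * y) ∘ (fun y => h * y) := by
    ext; simp [mul_assoc]
  unfold mulInvariantVectorField
  rw [h1]
  exact (mfderiv_comp_apply_eq (mul_one h)
    (mdifferentiableAt_mul_left g h) (mdifferentiableAt_mul_left (E := E) h 1) X).symm

/-- `Ad_g` followed by right translation by `g` is left translation by `g`. -/
theorem mfderiv_mul_right_Ad (g : G) (X : LieAlg (E := E) G) :
    mfderiv 𝓘(ℂ, E) 𝓘(ℂ, E) (fun y : G => y * g) 1 (Ad g X) =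
      (mulInvariantVectorField X g : E) := by
  have h1 : (fun y : G => g * y) = (fun y => y * g) ∘ (fun y => g * y * g⁻¹) := by
    ext; simp [mul_assoc]
  unfold mulInvariantVectorField Ad
  rw [h1]
  exact (mfderiv_comp_apply_eq (by simp) (mdifferentiableAt_mul_right g 1)
    (mdifferentiableAt_conj (E := E) g 1) X).symm

theorem Ad_mul_apply (g h : G) (X : LieAlg (E := E) G) : Ad (g * h) X = Ad g (Ad h X) := by
  have h1 : (fun y : G => g * h * y * (g * h)⁻¹) =
      (fun y => g * y * g⁻¹) ∘ (fun y => h * y * h⁻¹) := by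
    ext; simp [mul_assoc]
  unfold Ad
  rw [h1]
  exact mfderiv_comp_apply_eq (by simp) (mdifferentiableAt_conj g 1)
    (mdifferentiableAt_conj (E := E) h 1) X

theorem Ad_inv_apply_Ad (g : G) (X : LieAlg (E := E) G) : Ad g⁻¹ (Ad g X) = X := by
  rw [← Ad_mul_apply, inv_mul_cancel, Ad_one]; rfl

theorem Ad_apply_Ad_inv (g : G) (X : LieAlg (E := E) G) : Ad g (Ad g⁻¹ X) = X := by
  rw [← Ad_mul_apply, mul_inv_cancel, Ad_one]; rfl

theorem mfderiv_mul_right_mulInvariantVectorField (g h : G) (X : LieAlg (E := E) G) :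
    mfderiv 𝓘(ℂ, E) 𝓘(ℂ, E) (fun y : G => y * h) g (mulInvariantVectorField X g) =
      mulInvariantVectorField (Ad h⁻¹ X) (g * h) := by
  have h1 : (fun y : G => y * h) ∘ (fun y => g * y) =
      (fun y => g * h * y) ∘ (fun y => h⁻¹ * y * h⁻¹⁻¹) := by
    ext; simp [mul_assoc]
  unfold mulInvariantVectorField Ad
  have e1 := mfderiv_comp_apply_eq (mul_one g) (mdifferentiableAt_mul_right h g)
    (mdifferentiableAt_mul_left (E := E) g 1) X
  have e2 := mfderiv_comp_apply_eq (by simp) (mdifferentiableAt_mul_left (g * h) 1)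
    (mdifferentiableAt_conj (E := E) h⁻¹ 1) X
  rw [h1] at e1
  exact e1.symm.trans e2

/-- Product rule: `(F K)⁻¹ (F K)_z = Ad_{K⁻¹} (F⁻¹ F_z) + K⁻¹ K_z`. -/
theorem HasLeftLogDerivAt.mul {F K : ℂ → G} {X Y : LieAlg (E := E) G} {z : ℂ}
    (hF : HasLeftLogDerivAt F X z) (hK : HasLeftLogDerivAt K Y z) :
    HasLeftLogDerivAt (fun z => F z * K z) (Ad (K z)⁻¹ X + Y) z := by
  have hm : MDifferentiableAt (𝓘(ℂ, E).prod 𝓘(ℂ, E)) 𝓘(ℂ, E) (fun p : G × G => p.1 * p.2)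
      (F z, K z) :=
    (contMDiff_mul 𝓘(ℂ, E) ω (G := G)).contMDiffAt.mdifferentiableAt (by simp)
  have h1 := hm.hasMFDerivAt.comp z (HasMFDerivAt.prodMk hF hK)
  refine h1.congr_mfderiv ?_
  refine ContinuousLinearMap.ext fun (t : ℂ) => ?_
  refine (mfderiv_prod_eq_add_apply hm).trans ?_
  have e1 := mfderiv_mul_right_mulInvariantVectorField (F z) (K z) X
  have e2 := mfderiv_mul_left_mulInvariantVectorField (F z) (K z) Y
  have e3 := congrFun (mulInvariantVectorField_add (I := 𝓘(ℂ, E)) (G := G)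
    (Ad (K z)⁻¹ X) Y) (F z * K z)
  calc _ = mfderiv 𝓘(ℂ, E) 𝓘(ℂ, E) (fun y : G => y * K z) (F z)
        (t • mulInvariantVectorField X (F z)) +
        mfderiv 𝓘(ℂ, E) 𝓘(ℂ, E) (fun y : G => F z * y) (K z)
        (t • mulInvariantVectorField Y (K z)) := rfl
    _ = t • (mulInvariantVectorField (Ad (K z)⁻¹ X + Y) (F z * K z)) := by
      rw [map_smul, map_smul, e1, e2, e3, Pi.add_apply, smul_add]
    _ = _ := rfl

theorem mulInvariantVectorField_left_injective {g : G} {X Y : LieAlg (E := E) G}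
    (h : mulInvariantVectorField X g = mulInvariantVectorField Y g) : X = Y := by
  have e1 := mfderiv_mul_left_mulInvariantVectorField g⁻¹ g X
  rw [h, mfderiv_mul_left_mulInvariantVectorField g⁻¹ g Y, inv_mul_cancel,
    mulInvariantVectorField_one, mulInvariantVectorField_one] at e1
  exact e1.symm

theorem mulInvariantVectorField_surjective (g : G) (v : TangentSpace 𝓘(ℂ, E) g) :
    ∃ X : LieAlg (E := E) G, mulInvariantVectorField X g = v := by
  refine ⟨(mfderiv 𝓘(ℂ, E) 𝓘(ℂ, E) (fun y : G => g⁻¹ * y) g v : E), ?_⟩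
  have h1 : (fun y : G => g * y) ∘ (fun y => g⁻¹ * y) = id := by ext; simp
  have e1 := mfderiv_comp_apply_eq (by simp) (mdifferentiableAt_mul_left g 1)
    (mdifferentiableAt_mul_left (E := E) g⁻¹ g) v
  rw [h1, mfderiv_id] at e1
  exact e1.symm

theorem HasLeftLogDerivAt.unique {F : ℂ → G} {X Y : LieAlg (E := E) G} {z : ℂ}
    (hX : HasLeftLogDerivAt F X z) (hY : HasLeftLogDerivAt F Y z) : X = Y := by
  have h := hasMFDerivAt_unique hX hY
  have h1 := congrArg (fun (T : ℂ →L[ℂ] E) => T 1) h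
  apply mulInvariantVectorField_left_injective (g := F z)
  calc mulInvariantVectorField X (F z) = (1 : ℂ) • mulInvariantVectorField X (F z) :=
        (one_smul _ _).symm
    _ = (1 : ℂ) • mulInvariantVectorField Y (F z) := h1
    _ = _ := one_smul _ _

theorem exists_hasLeftLogDerivAt {F : ℂ → G} {z : ℂ}
    (hF : MDifferentiableAt 𝓘(ℂ, ℂ) 𝓘(ℂ, E) F z) :
    ∃ X : LieAlg (E := E) G, HasLeftLogDerivAt F X z := by
  obtain ⟨X, hX⟩ := mulInvariantVectorField_surjective (F z)
    (mfderiv 𝓘(ℂ, ℂ) 𝓘(ℂ, E) F z (1 : ℂ))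
  refine ⟨X, hF.hasMFDerivAt.congr_mfderiv ?_⟩
  refine ContinuousLinearMap.ext fun (t : ℂ) => ?_
  rw [hX]
  calc _ = mfderiv 𝓘(ℂ, ℂ) 𝓘(ℂ, E) F z (t • (1 : ℂ)) := by rw [smul_eq_mul, mul_one]
    _ = t • mfderiv 𝓘(ℂ, ℂ) 𝓘(ℂ, E) F z (1 : ℂ) :=
      map_smul (mfderiv 𝓘(ℂ, ℂ) 𝓘(ℂ, E) F z : ℂ →L[ℂ] E) t (1 : ℂ)
    _ = _ := rfl

theorem HasLeftLogDerivAt.inv {F : ℂ → G} {X : LieAlg (E := E) G} {z : ℂ}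
    (hF : HasLeftLogDerivAt F X z) :
    HasLeftLogDerivAt (fun z => (F z)⁻¹) (-Ad (F z) X) z := by
  have hi : MDifferentiableAt 𝓘(ℂ, E) 𝓘(ℂ, E) (fun y : G => y⁻¹) (F z) :=
    (contMDiff_inv 𝓘(ℂ, E) ω (G := G)).contMDiffAt.mdifferentiableAt (by simp)
  -- The inverse has some logarithmic derivative `Y`; the product rule for `F F⁻¹ = 1` determines it.
  obtain ⟨Y, hY⟩ := exists_hasLeftLogDerivAt (hi.comp z hF.mdifferentiableAt)
  have h1 := hF.mul hY
  have h2 : (fun z => F z * ((fun y : G => y⁻¹) ∘ F) z) = fun _ => 1 := by ext; simp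
  rw [h2] at h1
  have h3 := h1.unique (hasLeftLogDerivAt_const 1 z)
  have h4 : Y = -Ad (F z) X := by
    rw [eq_neg_iff_add_eq_zero, add_comm]
    simpa using h3
  rw [← h4]
  exact hY

theorem HasLeftLogDerivAt.const_mul {F : ℂ → G} {X : LieAlg (E := E) G} {z : ℂ}
    (hF : HasLeftLogDerivAt F X z) (g : G) : HasLeftLogDerivAt (fun z => g * F z) X z := by
  simpa using (hasLeftLogDerivAt_const (E := E) g z).mul hF

theorem HasLeftLogDerivAt.conj {F : ℂ → G} {X : LieAlg (E := E) G} {z : ℂ}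
    (hF : HasLeftLogDerivAt F X z) (g : G) :
    HasLeftLogDerivAt (fun z => g * F z * g⁻¹) (Ad g X) z := by
  simpa using (hF.const_mul g).mul (hasLeftLogDerivAt_const (E := E) g⁻¹ z)

/-- Two holomorphic maps with the same left logarithmic derivative differ by a locally constant
factor. -/
theorem HasLeftLogDerivAt.mul_inv {F K : ℂ → G} {X : LieAlg (E := E) G} {z : ℂ}
    (hF : HasLeftLogDerivAt F X z) (hK : HasLeftLogDerivAt K X z) :
    HasLeftLogDerivAt (E := E) (fun z => F z * (K z)⁻¹) 0 z := by
  simpa using hF.mul hK.inv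

/-- The chart representative of a map is differentiable, with derivative the image of the left
translate of the logarithmic derivative. -/
theorem HasLeftLogDerivAt.hasDerivAt_extChartAt {F : ℂ → G} {X : LieAlg (E := E) G} {z : ℂ} {g : G}
    (hF : HasLeftLogDerivAt F X z) (hg : F z ∈ (extChartAt 𝓘(ℂ, E) g).source) :
    HasDerivAt (fun w => extChartAt 𝓘(ℂ, E) g (F w))
      (mfderiv 𝓘(ℂ, E) 𝓘(ℂ, E) (extChartAt 𝓘(ℂ, E) g) (F z) (mulInvariantVectorField X (F z)) : E)
      z := by
  have : IsManifold 𝓘(ℂ, E) 1 G := IsManifold.of_le (n := ω) (by simp)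
  have he := (mdifferentiableAt_extChartAt (I := 𝓘(ℂ, E))
    (by simpa using hg : F z ∈ (chartAt E g).source)).hasMFDerivAt
  let D : E →L[ℂ] E := mfderiv 𝓘(ℂ, E) 𝓘(ℂ, E) (extChartAt 𝓘(ℂ, E) g) (F z)
  let V : E := mulInvariantVectorField X (F z)
  have h1 : HasFDerivAt (fun w => extChartAt 𝓘(ℂ, E) g (F w))
      (D.comp ((1 : ℂ →L[ℂ] ℂ).smulRight V)) z :=
    (he.comp z hF).hasFDerivAt
  have h2 := h1.hasDerivAt
  refine h2.congr_deriv ?_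
  calc _ = D ((1 : ℂ) • V) := rfl
    _ = D V := by rw [one_smul]

theorem eventuallyEq_of_hasLeftLogDerivAt_zero {F : ℂ → G} {z : ℂ}
    (hF : ∀ᶠ w in 𝓝 z, HasLeftLogDerivAt (E := E) F 0 w) : ∀ᶠ w in 𝓝 z, F w = F z := by
  set e := extChartAt 𝓘(ℂ, E) (F z)
  have hc : ContinuousAt F z := hF.self_of_nhds.1
  have h1 : ∀ᶠ w in 𝓝 z, F w ∈ e.source := hc (extChartAt_source_mem_nhds (F z))
  obtain ⟨r, hr, hb⟩ := Metric.eventually_nhds_iff_ball.mp (hF.and h1)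
  filter_upwards [Metric.ball_mem_nhds z hr] with w hw
  have hd (u : ℂ) (hu : u ∈ Metric.ball z r) : HasDerivAt (fun w => e (F w)) 0 u := by
    refine ((hb u hu).1.hasDerivAt_extChartAt (hb u hu).2).congr_deriv ?_
    have e1 : mulInvariantVectorField (0 : LieAlg (E := E) G) (F u) = 0 :=
      map_zero (mfderiv 𝓘(ℂ, E) 𝓘(ℂ, E) (fun y : G => F u * y) 1)
    rw [e1, map_zero]
    rfl
  have h2 := Metric.isOpen_ball.is_const_of_deriv_eq_zero
    (convex_ball z r).isPreconnected
    (fun u hu => (hd u hu).differentiableAt.differentiableWithinAt)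
    (fun u hu => (hd u hu).deriv) hw (Metric.mem_ball_self hr)
  exact e.injOn (hb w hw).2 (hb z (Metric.mem_ball_self hr)).2 h2

/-- A map with vanishing derivative on a preconnected open set is constant on it. -/
theorem eq_of_hasLeftLogDerivAt_zero {F : ℂ → G} {U : Set ℂ} (hU : IsOpen U)
    (hc : IsPreconnected U) (hF : ∀ z ∈ U, HasLeftLogDerivAt (E := E) F 0 z) {z w : ℂ}
    (hz : z ∈ U) (hw : w ∈ U) : F w = F z := by
  by_contra hne
  have hloc (u : ℂ) (hu : u ∈ U) : ∀ᶠ v in 𝓝 u, v ∈ U ∧ F v = F u :=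
    (hU.eventually_mem hu).and (eventuallyEq_of_hasLeftLogDerivAt_zero
      ((hU.eventually_mem hu).mono hF))
  obtain ⟨u, hu, ⟨_, h1⟩, _, h2⟩ := hc {u | u ∈ U ∧ F u = F z} {u | u ∈ U ∧ F u ≠ F z}
    (isOpen_iff_mem_nhds.mpr fun u hu => by
      filter_upwards [hloc u hu.1] with v hv using ⟨hv.1, hv.2.trans hu.2⟩)
    (isOpen_iff_mem_nhds.mpr fun u hu => by
      filter_upwards [hloc u hu.1] with v hv using ⟨hv.1, by rw [hv.2]; exact hu.2⟩)
    (fun u hu => by by_cases h : F u = F z <;> simp [hu, h])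
    ⟨z, hz, hz, rfl⟩ ⟨w, hw, hw, hne⟩
  exact h2 h1

/-- Uniqueness of solutions of `F⁻¹ F_z = X`, up to a constant left factor. -/
theorem HasLeftLogDerivAt.mul_inv_eq {F K : ℂ → G} {X : ℂ → LieAlg (E := E) G}
    {U : Set ℂ} (hU : IsOpen U) (hc : IsPreconnected U)
    (hF : ∀ z ∈ U, HasLeftLogDerivAt F (X z) z) (hK : ∀ z ∈ U, HasLeftLogDerivAt K (X z) z)
    {z w : ℂ} (hz : z ∈ U) (hw : w ∈ U) : F w * (K w)⁻¹ = F z * (K z)⁻¹ :=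
  eq_of_hasLeftLogDerivAt_zero (F := fun z => F z * (K z)⁻¹) hU hc
    (fun u hu => (hF u hu).mul_inv (hK u hu)) hz hw

end Calculus

/-! ### Holomorphic ordinary differential equations -/

section ODE

variable {E : Type*} [NormedAddCommGroup E] [NormedSpace ℂ E] [CompleteSpace E]

/-- One Picard iterate: a primitive of `v ∘ y` with initial value `x₀`. -/
theorem exists_picard_step {v : E → E} {x₀ : E} {a r M : ℝ} (hr : 0 < r)
    (hv : DifferentiableOn ℂ v (Metric.ball x₀ a)) (hM : ∀ x ∈ Metric.ball x₀ a, ‖v x‖ ≤ M)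
    {y : ℂ → E} (hy : DifferentiableOn ℂ y (Metric.ball 0 r))
    (hya : ∀ z ∈ Metric.ball (0 : ℂ) r, y z ∈ Metric.ball x₀ a) :
    ∃ u : ℂ → E, u 0 = x₀ ∧ (∀ z ∈ Metric.ball (0 : ℂ) r, HasDerivAt u (v (y z)) z) ∧
      ∀ z ∈ Metric.ball (0 : ℂ) r, ‖u z - x₀‖ ≤ M * ‖z‖ := by
  obtain ⟨u, hu0, hu⟩ :=
    Complex.IsExactOn.with_val_at (hv.comp hy hya).isExactOn_ball 0 x₀
  refine ⟨u, hu0, hu, fun z hz => ?_⟩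
  have h := (convex_ball (0 : ℂ) r).norm_image_sub_le_of_norm_hasDerivWithin_le
    (fun w hw => (hu w hw).hasDerivWithinAt) (fun w hw => hM _ (hya w hw))
    (Metric.mem_ball_self hr) hz
  simpa [hu0] using h

/-- Holomorphic Picard–Lindelöf: a holomorphic Lipschitz vector field has a holomorphic integral
curve on a disc of explicit radius, with an explicit bound. -/
theorem exists_hasDerivAt_of_differentiableOn {v : E → E} {x₀ : E} {a r M : ℝ} {K : NNReal}
    (ha : 0 < a) (hr : 0 < r)
    (hv : DifferentiableOn ℂ v (Metric.ball x₀ a)) (hM : ∀ x ∈ Metric.ball x₀ a, ‖v x‖ ≤ M)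
    (hK : LipschitzOnWith K v (Metric.ball x₀ a)) (hrM : M * r < a) (hrK : K * r < 1) :
    ∃ y : ℂ → E, y 0 = x₀ ∧ (∀ z ∈ Metric.ball (0 : ℂ) r, HasDerivAt y (v (y z)) z) ∧
      ∀ z ∈ Metric.ball (0 : ℂ) r, ‖y z - x₀‖ ≤ M * ‖z‖ := by
  have hM0 : 0 ≤ M := (norm_nonneg _).trans (hM x₀ (Metric.mem_ball_self ha))
  let S := {y : ℂ → E // y 0 = x₀ ∧ DifferentiableOn ℂ y (Metric.ball 0 r) ∧
    ∀ z ∈ Metric.ball (0 : ℂ) r, ‖y z - x₀‖ ≤ M * ‖z‖}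
  have hlt (z : ℂ) (hz : z ∈ Metric.ball (0 : ℂ) r) {x : E} (hx : ‖x - x₀‖ ≤ M * ‖z‖) :
      x ∈ Metric.ball x₀ a := by
    rw [mem_ball_iff_norm]
    rw [mem_ball_zero_iff] at hz
    exact hx.trans_lt ((mul_le_mul_of_nonneg_left hz.le hM0).trans_lt hrM)
  have hstep (y : S) : ∃ u : S, ∀ z ∈ Metric.ball (0 : ℂ) r, HasDerivAt u.1 (v (y.1 z)) z := by
    obtain ⟨u, h1, h2, h3⟩ := exists_picard_step hr hv hM y.2.2.1
      (fun z hz => hlt z hz (y.2.2.2 z hz))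
    exact ⟨⟨u, h1, fun z hz => (h2 z hz).differentiableAt.differentiableWithinAt, h3⟩, h2⟩
  choose N hN using hstep
  let y₀ : S := ⟨fun _ => x₀, rfl, differentiableOn_const _, fun z _ => by
    simpa using mul_nonneg hM0 (norm_nonneg z)⟩
  let y : ℕ → S := fun n => N^[n] y₀
  have hy (n : ℕ) (z : ℂ) (hz : z ∈ Metric.ball (0 : ℂ) r) :
      HasDerivAt (y (n + 1)).1 (v ((y n).1 z)) z := by
    have : y (n + 1) = N (y n) := Function.iterate_succ_apply' N n y₀
    rw [this]
    exact hN (y n) z hz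
  have hmem (n : ℕ) (z : ℂ) (hz : z ∈ Metric.ball (0 : ℂ) r) :
      (y n).1 z ∈ Metric.ball x₀ a := hlt z hz ((y n).2.2.2 z hz)
  have hq0 : 0 ≤ K * r := mul_nonneg K.2 hr.le
  have hdist (n : ℕ) : ∀ z ∈ Metric.ball (0 : ℂ) r,
      dist ((y n).1 z) ((y (n + 1)).1 z) ≤ a * (K * r) ^ n := by
    induction n with
    | zero =>
      intro z hz
      have := hmem 1 z hz
      rw [dist_comm]
      simpa [y, y₀] using (Metric.mem_ball.mp this).le
    | succ n ih =>
      intro z hz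
      have h := (convex_ball (0 : ℂ) r).norm_image_sub_le_of_norm_hasDerivWithin_le
        (C := K * (a * (K * r) ^ n))
        (fun w hw => ((hy n w hw).sub (hy (n + 1) w hw)).hasDerivWithinAt)
        (fun w hw => by
          rw [← dist_eq_norm]
          exact (hK.dist_le_mul _ (hmem n w hw) _ (hmem (n + 1) w hw)).trans
            (mul_le_mul_of_nonneg_left (ih w hw) K.2))
        (Metric.mem_ball_self hr) hz
      rw [mem_ball_zero_iff] at hz
      have h0 : (y (n + 1)).1 0 - (y (n + 1 + 1)).1 0 = 0 := by
        rw [(y (n + 1)).2.1, (y (n + 1 + 1)).2.1, sub_self]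
      rw [dist_eq_norm]
      simp only [Pi.sub_apply, h0, sub_zero] at h
      refine h.trans ((mul_le_mul_of_nonneg_left hz.le (by positivity)).trans (le_of_eq ?_))
      ring
  have hlim (z : ℂ) : ∃ l, z ∈ Metric.ball (0 : ℂ) r →
      Filter.Tendsto (fun n => (y n).1 z) Filter.atTop (𝓝 l) := by
    by_cases hz : z ∈ Metric.ball (0 : ℂ) r
    · obtain ⟨l, hl⟩ := cauchySeq_tendsto_of_complete
        (cauchySeq_of_le_geometric _ _ hrK (fun n => hdist n z hz))
      exact ⟨l, fun _ => hl⟩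
    · exact ⟨x₀, fun h => absurd h hz⟩
  choose l hl using hlim
  have hunif : TendstoUniformlyOn (fun n => (y n).1) l Filter.atTop (Metric.ball (0 : ℂ) r) := by
    rw [Metric.tendstoUniformlyOn_iff]
    intro ε hε
    have h0 : Filter.Tendsto (fun n => a * (K * r) ^ n / (1 - K * r)) Filter.atTop (𝓝 0) := by
      simpa using ((tendsto_pow_atTop_nhds_zero_of_lt_one hq0 hrK).const_mul a).div_const
        (1 - K * r)
    filter_upwards [h0.eventually_lt_const hε] with n hn z hz
    rw [dist_comm]
    exact (dist_le_of_le_geometric_of_tendsto _ _ hrK (fun n => hdist n z hz) (hl z hz) n).trans_lt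
      hn
  have hbound (z : ℂ) (hz : z ∈ Metric.ball (0 : ℂ) r) : ‖l z - x₀‖ ≤ M * ‖z‖ :=
    le_of_tendsto ((hl z hz).sub_const x₀).norm (Filter.Eventually.of_forall fun n =>
      (y n).2.2.2 z hz)
  refine ⟨l, ?_, fun z hz => ?_, hbound⟩
  · refine tendsto_nhds_unique (hl 0 (Metric.mem_ball_self hr)) ?_
    simp only [(y _).2.1]
    exact tendsto_const_nhds
  · have hunif' : TendstoUniformlyOn (fun n => fun w => v ((y n).1 w)) (fun w => v (l w))
        Filter.atTop (Metric.ball (0 : ℂ) r) := by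
      rw [Metric.tendstoUniformlyOn_iff] at hunif ⊢
      intro ε hε
      filter_upwards [hunif (ε / (K + 1)) (by positivity)] with n hn w hw
      refine (hK.dist_le_mul _ (hlt w hw (hbound w hw)) _ (hmem n w hw)).trans_lt ?_
      have h1 := hn w hw
      rw [lt_div_iff₀ (by positivity)] at h1
      nlinarith [dist_nonneg (x := l w) (y := (y n).1 w)]
    exact hasDerivAt_of_tendstoUniformlyOn Metric.isOpen_ball hunif'
      (Filter.Eventually.of_forall fun n w hw => hy n w hw)
      (fun w hw => (hl w hw).comp (Filter.tendsto_add_atTop_nat 1)) hz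

end ODE

/-! ### The multiplication in the chart at the identity -/

section Chart

variable {E : Type*} [NormedAddCommGroup E] [NormedSpace ℂ E]
  (G : Type*) [TopologicalSpace G] [ChartedSpace E G] [Group G]

/-- The multiplication of `G`, read in the chart at the identity in both arguments. -/
def chartMul (p : E × E) : E :=
  extChartAt 𝓘(ℂ, E) (1 : G)
    ((extChartAt 𝓘(ℂ, E) (1 : G)).symm p.1 * (extChartAt 𝓘(ℂ, E) (1 : G)).symm p.2)

/-- The coordinates of the identity. -/
def chartOne : E := extChartAt 𝓘(ℂ, E) (1 : G) 1

variable {G}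

theorem chartOne_mem_target : chartOne (E := E) G ∈ (extChartAt 𝓘(ℂ, E) (1 : G)).target :=
  mem_extChartAt_target 1

theorem extChartAt_symm_chartOne : (extChartAt 𝓘(ℂ, E) (1 : G)).symm (chartOne G) = 1 :=
  extChartAt_to_inv 1

theorem target_mem_nhds_chartOne :
    (extChartAt 𝓘(ℂ, E) (1 : G)).target ∈ 𝓝 (chartOne (E := E) G) :=
  extChartAt_target_mem_nhds 1

variable [LieGroup 𝓘(ℂ, E) ω G]

theorem mdifferentiableAt_extChartAt_one_symm {x : E}
    (hx : x ∈ (extChartAt 𝓘(ℂ, E) (1 : G)).target) :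
    MDifferentiableAt 𝓘(ℂ, E) 𝓘(ℂ, E) (extChartAt 𝓘(ℂ, E) (1 : G)).symm x := by
  have : IsManifold 𝓘(ℂ, E) 1 G := IsManifold.of_le (n := ω) (by simp)
  have h := mdifferentiableWithinAt_extChartAt_symm hx
  simpa [mdifferentiableWithinAt_univ] using h

theorem mdifferentiableAt_extChartAt_one {g : G}
    (hg : g ∈ (extChartAt 𝓘(ℂ, E) (1 : G)).source) :
    MDifferentiableAt 𝓘(ℂ, E) 𝓘(ℂ, E) (extChartAt 𝓘(ℂ, E) (1 : G)) g := by
  have : IsManifold 𝓘(ℂ, E) 1 G := IsManifold.of_le (n := ω) (by simp)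
  exact mdifferentiableAt_extChartAt (by simpa using hg)

theorem contDiffAt_chartMul {p : E × E} (h1 : p.1 ∈ (extChartAt 𝓘(ℂ, E) (1 : G)).target)
    (h2 : p.2 ∈ (extChartAt 𝓘(ℂ, E) (1 : G)).target)
    (h12 : (extChartAt 𝓘(ℂ, E) (1 : G)).symm p.1 * (extChartAt 𝓘(ℂ, E) (1 : G)).symm p.2 ∈
      (extChartAt 𝓘(ℂ, E) (1 : G)).source) :
    ContDiffAt ℂ ω (chartMul G) p := by
  rw [← contMDiffAt_iff_contDiffAt]
  have hs (x : E) (hx : x ∈ (extChartAt 𝓘(ℂ, E) (1 : G)).target) :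
      ContMDiffAt 𝓘(ℂ, E) 𝓘(ℂ, E) ω (extChartAt 𝓘(ℂ, E) (1 : G)).symm x :=
    (contMDiffOn_extChartAt_symm (1 : G)).contMDiffAt
      ((isOpen_extChartAt_target (1 : G)).mem_nhds hx)
  have hf : ContMDiffAt 𝓘(ℂ, E × E) 𝓘(ℂ, E) ω (Prod.fst : E × E → E) p :=
    contDiff_fst.contDiffAt.contMDiffAt
  have hg : ContMDiffAt 𝓘(ℂ, E × E) 𝓘(ℂ, E) ω (Prod.snd : E × E → E) p :=
    contDiff_snd.contDiffAt.contMDiffAt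
  have h3 := ((hs _ h1).comp p hf).mul ((hs _ h2).comp p hg)
  exact ContMDiffAt.comp p (contMDiffAt_extChartAt' (by simpa using h12)) h3

theorem contDiffAt_chartMul_one : ContDiffAt ℂ ω (chartMul G) (chartOne (E := E) G, chartOne G) := by
  refine contDiffAt_chartMul chartOne_mem_target chartOne_mem_target ?_
  simp only [extChartAt_symm_chartOne, one_mul]
  exact mem_extChartAt_source 1

/-- In the chart at the identity, the differential of the coordinate map inverts that of the
parametrisation. -/
theorem mfderiv_extChartAt_symm_apply_mfderiv {x : E}
    (hx : x ∈ (extChartAt 𝓘(ℂ, E) (1 : G)).target)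
    (v : TangentSpace 𝓘(ℂ, E) ((extChartAt 𝓘(ℂ, E) (1 : G)).symm x)) :
    mfderiv 𝓘(ℂ, E) 𝓘(ℂ, E) (extChartAt 𝓘(ℂ, E) (1 : G)).symm x
      (mfderiv 𝓘(ℂ, E) 𝓘(ℂ, E) (extChartAt 𝓘(ℂ, E) (1 : G))
        ((extChartAt 𝓘(ℂ, E) (1 : G)).symm x) v : E) = v := by
  have : IsManifold 𝓘(ℂ, E) 1 G := IsManifold.of_le (n := ω) (by simp)
  have h := mfderivWithin_extChartAt_symm_comp_mfderiv_extChartAt (I := 𝓘(ℂ, E)) hx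
  rw [modelWithCornersSelf_coe, Set.range_id, mfderivWithin_univ] at h
  exact DFunLike.congr_fun h v

theorem mfderiv_extChartAt_symm_chartOne :
    mfderiv 𝓘(ℂ, E) 𝓘(ℂ, E) (extChartAt 𝓘(ℂ, E) (1 : G)).symm (chartOne G) =
      ContinuousLinearMap.id ℂ E := by
  have : IsManifold 𝓘(ℂ, E) 1 G := IsManifold.of_le (n := ω) (by simp)
  have h := mfderivWithin_range_extChartAt_symm (I := 𝓘(ℂ, E)) (x := (1 : G))
  rw [modelWithCornersSelf_coe, Set.range_id, mfderivWithin_univ] at h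
  exact h

/-- The derivative of multiplication in the second variable at the identity is the left-invariant
vector field, read in the chart. -/
theorem fderiv_chartMul_snd {x : E} (hx : x ∈ (extChartAt 𝓘(ℂ, E) (1 : G)).target)
    (X : LieAlg (E := E) G) :
    fderiv ℂ (chartMul G) (x, chartOne G) (0, (X : E)) =
      mfderiv 𝓘(ℂ, E) 𝓘(ℂ, E) (extChartAt 𝓘(ℂ, E) (1 : G))
        ((extChartAt 𝓘(ℂ, E) (1 : G)).symm x)
        (mulInvariantVectorField X ((extChartAt 𝓘(ℂ, E) (1 : G)).symm x)) := by
  set e := extChartAt 𝓘(ℂ, E) (1 : G)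
  set g : G := e.symm x
  have hgs : g ∈ e.source := e.map_target hx
  have hM : DifferentiableAt ℂ (chartMul G) (x, chartOne (E := E) G) := by
    refine (contDiffAt_chartMul hx chartOne_mem_target ?_).differentiableAt (by simp)
    simp only [extChartAt_symm_chartOne, mul_one]
    exact e.map_target hx
  have h1 : HasFDerivAt (fun y : E => chartMul G (x, y))
      ((fderiv ℂ (chartMul G) (x, chartOne G)).comp (ContinuousLinearMap.inr ℂ E E))
      (chartOne G) := hM.hasFDerivAt.comp (f := fun y : E => (x, y)) (chartOne G)
      (hasFDerivAt_prodMk_right x (chartOne G))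
  have h2 : HasMFDerivAt 𝓘(ℂ, E) 𝓘(ℂ, E) e.symm (chartOne (E := E) G)
      (ContinuousLinearMap.id ℂ E) := by
    rw [← mfderiv_extChartAt_symm_chartOne]
    exact (mdifferentiableAt_extChartAt_one_symm chartOne_mem_target).hasMFDerivAt
  have h3 : HasMFDerivAt 𝓘(ℂ, E) 𝓘(ℂ, E) (fun y : G => g * y) (e.symm (chartOne G))
      (mfderiv 𝓘(ℂ, E) 𝓘(ℂ, E) (fun y : G => g * y) 1 : E →L[ℂ] E) := by
    rw [extChartAt_symm_chartOne]
    exact (mdifferentiableAt_mul_left g 1).hasMFDerivAt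
  have h4 : HasMFDerivAt 𝓘(ℂ, E) 𝓘(ℂ, E) e (g * e.symm (chartOne G))
      (mfderiv 𝓘(ℂ, E) 𝓘(ℂ, E) e g : E →L[ℂ] E) := by
    rw [extChartAt_symm_chartOne, mul_one]
    exact (mdifferentiableAt_extChartAt_one hgs).hasMFDerivAt
  have h5 : HasFDerivAt (fun y : E => e ((fun y : E => g * e.symm y) y))
      ((mfderiv 𝓘(ℂ, E) 𝓘(ℂ, E) e g : E →L[ℂ] E).comp
        ((mfderiv 𝓘(ℂ, E) 𝓘(ℂ, E) (fun y : G => g * y) 1 : E →L[ℂ] E).comp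
          (ContinuousLinearMap.id ℂ E))) (chartOne G) :=
    (HasMFDerivAt.comp (f := fun y : E => g * e.symm y) (chartOne G) h4
      (h3.comp (chartOne G) h2)).hasFDerivAt
  have h6 := h1.unique h5
  have h7 := congrArg (fun (T : E →L[ℂ] E) => T X) h6
  exact h7

/-- The derivative of multiplication in the first variable at the identity, read in the chart, in
terms of right translation. -/
theorem fderiv_chartMul_fst {x : E} (hx : x ∈ (extChartAt 𝓘(ℂ, E) (1 : G)).target)
    (X : LieAlg (E := E) G) :
    fderiv ℂ (chartMul G) (chartOne G, x) ((X : E), 0) =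
      mfderiv 𝓘(ℂ, E) 𝓘(ℂ, E) (extChartAt 𝓘(ℂ, E) (1 : G))
        ((extChartAt 𝓘(ℂ, E) (1 : G)).symm x)
        (mfderiv 𝓘(ℂ, E) 𝓘(ℂ, E) (fun y : G => y * (extChartAt 𝓘(ℂ, E) (1 : G)).symm x) 1 X : E)
        := by
  set e := extChartAt 𝓘(ℂ, E) (1 : G)
  set g : G := e.symm x
  have hgs : g ∈ e.source := e.map_target hx
  have hM : DifferentiableAt ℂ (chartMul G) (chartOne (E := E) G, x) := by
    refine (contDiffAt_chartMul chartOne_mem_target hx ?_).differentiableAt (by simp)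
    simp only [extChartAt_symm_chartOne, one_mul]
    exact e.map_target hx
  have h1 : HasFDerivAt (fun y : E => chartMul G (y, x))
      ((fderiv ℂ (chartMul G) (chartOne G, x)).comp (ContinuousLinearMap.inl ℂ E E))
      (chartOne G) := hM.hasFDerivAt.comp (f := fun y : E => (y, x)) (chartOne G)
      (hasFDerivAt_prodMk_left (chartOne G) x)
  have h2 : HasMFDerivAt 𝓘(ℂ, E) 𝓘(ℂ, E) e.symm (chartOne (E := E) G)
      (ContinuousLinearMap.id ℂ E) := by
    rw [← mfderiv_extChartAt_symm_chartOne]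
    exact (mdifferentiableAt_extChartAt_one_symm chartOne_mem_target).hasMFDerivAt
  have h3 : HasMFDerivAt 𝓘(ℂ, E) 𝓘(ℂ, E) (fun y : G => y * g) (e.symm (chartOne G))
      (mfderiv 𝓘(ℂ, E) 𝓘(ℂ, E) (fun y : G => y * g) 1 : E →L[ℂ] E) := by
    rw [extChartAt_symm_chartOne]
    exact (mdifferentiableAt_mul_right g 1).hasMFDerivAt
  have h4 : HasMFDerivAt 𝓘(ℂ, E) 𝓘(ℂ, E) e (e.symm (chartOne G) * g)
      (mfderiv 𝓘(ℂ, E) 𝓘(ℂ, E) e g : E →L[ℂ] E) := by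
    rw [extChartAt_symm_chartOne, one_mul]
    exact (mdifferentiableAt_extChartAt_one hgs).hasMFDerivAt
  have h5 : HasFDerivAt (fun y : E => e ((fun y : E => e.symm y * g) y))
      ((mfderiv 𝓘(ℂ, E) 𝓘(ℂ, E) e g : E →L[ℂ] E).comp
        ((mfderiv 𝓘(ℂ, E) 𝓘(ℂ, E) (fun y : G => y * g) 1 : E →L[ℂ] E).comp
          (ContinuousLinearMap.id ℂ E))) (chartOne G) :=
    (HasMFDerivAt.comp (f := fun y : E => e.symm y * g) (chartOne G) h4
      (h3.comp (chartOne G) h2)).hasFDerivAt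
  have h6 := h1.unique h5
  have h7 := congrArg (fun (T : E →L[ℂ] E) => T X) h6
  exact h7

end Chart

/-! ### The bracket as the differential of `Ad` -/

section Bracket

variable {E : Type*} [NormedAddCommGroup E] [NormedSpace ℂ E]
  {G : Type*} [TopologicalSpace G] [ChartedSpace E G] [Group G] [LieGroup 𝓘(ℂ, E) ω G]

theorem differentiableAt_fderiv_chartMul :
    DifferentiableAt ℂ (fderiv ℂ (chartMul G)) (chartOne (E := E) G, chartOne G) :=
  (contDiffAt_chartMul_one.fderiv_right (m := 1) (by simp)).differentiableAt (by simp)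

/-- The second derivative of the multiplication at the identity. -/
def chartMulSecond (G : Type*) [TopologicalSpace G] [ChartedSpace E G] [Group G] :
    E × E →L[ℂ] E × E →L[ℂ] E :=
  fderiv ℂ (fderiv ℂ (chartMul G)) (chartOne G, chartOne G)

theorem chartMulSecond_symm (v w : E × E) :
    chartMulSecond (E := E) G v w = chartMulSecond (E := E) G w v :=
  contDiffAt_chartMul_one.isSymmSndFDerivAt_of_omega.eq v w

theorem hasFDerivAt_fderiv_chartMul_snd (v : E) :
    HasFDerivAt (fun x : E => fderiv ℂ (chartMul G) (x, chartOne G) (0, v))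
      ((((ContinuousLinearMap.apply ℂ E ((0, v) : E × E)).comp (chartMulSecond (E := E) G))).comp
        (ContinuousLinearMap.inl ℂ E E)) (chartOne G) := by
  have h1 := differentiableAt_fderiv_chartMul (E := E) (G := G) |>.hasFDerivAt.comp
    (f := fun y : E => (y, chartOne G)) (chartOne G)
      (hasFDerivAt_prodMk_left (chartOne G) (chartOne G))
  exact (ContinuousLinearMap.apply ℂ E ((0, v) : E × E)).hasFDerivAt.comp _ h1

theorem hasFDerivAt_fderiv_chartMul_fst :
    HasFDerivAt (fun x : E => (fderiv ℂ (chartMul G) (chartOne G, x)).comp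
        (ContinuousLinearMap.inl ℂ E E))
      ((((ContinuousLinearMap.compL ℂ E (E × E) E).flip (ContinuousLinearMap.inl ℂ E E)).comp
        (chartMulSecond (E := E) G)).comp (ContinuousLinearMap.inr ℂ E E)) (chartOne G) := by
  have h1 := differentiableAt_fderiv_chartMul (E := E) (G := G) |>.hasFDerivAt.comp
    (f := fun y : E => (chartOne G, y)) (chartOne G)
      (hasFDerivAt_prodMk_right (chartOne G) (chartOne G))
  exact ((ContinuousLinearMap.compL ℂ E (E × E) E).flip
    (ContinuousLinearMap.inl ℂ E E)).hasFDerivAt.comp _ h1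

theorem fderiv_chartMul_fst_one :
    (fderiv ℂ (chartMul G) (chartOne (E := E) G, chartOne G)).comp
      (ContinuousLinearMap.inl ℂ E E) = ContinuousLinearMap.id ℂ E := by
  have hM : DifferentiableAt ℂ (chartMul G) (chartOne (E := E) G, chartOne G) :=
    contDiffAt_chartMul_one.differentiableAt (by simp)
  have h1 : HasFDerivAt (fun y : E => chartMul G (y, chartOne G))
      ((fderiv ℂ (chartMul G) (chartOne G, chartOne G)).comp (ContinuousLinearMap.inl ℂ E E))
      (chartOne G) := hM.hasFDerivAt.comp (f := fun y : E => (y, chartOne G)) (chartOne G)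
        (hasFDerivAt_prodMk_left (chartOne G) (chartOne G))
  refine h1.unique ((hasFDerivAt_id (chartOne G)).congr_of_eventuallyEq ?_)
  filter_upwards [target_mem_nhds_chartOne (G := G)] with y hy
  simp only [chartMul, extChartAt_symm_chartOne, mul_one, id]
  exact (extChartAt 𝓘(ℂ, E) (1 : G)).right_inv hy

theorem mfderiv_extChartAt_one_mulInvariantVectorField {g : G} (hg : g = 1)
    (X : LieAlg (E := E) G) :
    mfderiv 𝓘(ℂ, E) 𝓘(ℂ, E) (extChartAt 𝓘(ℂ, E) (1 : G)) g (mulInvariantVectorField X g) =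
      (X : E) := by
  have : IsManifold 𝓘(ℂ, E) 1 G := IsManifold.of_le (n := ω) (by simp)
  subst hg
  rw [mfderiv_extChartAt_self, mulInvariantVectorField_one]
  rfl

/-- The chart representative of a left-invariant vector field, in the form in which it enters the
definition of the bracket. -/
theorem mpullbackWithin_mulInvariantVectorField (X : LieAlg (E := E) G) :
    (VectorField.mpullbackWithin 𝓘(ℂ, E) 𝓘(ℂ, E) (extChartAt 𝓘(ℂ, E) (1 : G)).symm
      (mulInvariantVectorField X) Set.univ : E → E) =ᶠ[𝓝 (chartOne G)]
    fun x => fderiv ℂ (chartMul G) (x, chartOne G) (0, (X : E)) := by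
  have : IsManifold 𝓘(ℂ, E) 1 G := IsManifold.of_le (n := ω) (by simp)
  filter_upwards [target_mem_nhds_chartOne (G := G)] with x hx
  rw [fderiv_chartMul_snd hx X]
  have h1 := mfderivWithin_extChartAt_symm_comp_mfderiv_extChartAt (I := 𝓘(ℂ, E)) hx
  have h2 := mfderiv_extChartAt_comp_mfderivWithin_extChartAt_symm (I := 𝓘(ℂ, E)) hx
  rw [modelWithCornersSelf_coe, Set.range_id] at h1 h2
  rw [VectorField.mpullbackWithin_apply, ContinuousLinearMap.inverse_eq h1 h2]
  rfl

/-- The Lie bracket is the antisymmetrised mixed second derivative of the multiplication. -/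
theorem lie_eq_chartMulSecond (X Y : LieAlg (E := E) G) :
    (⁅X, Y⁆ : LieAlg (E := E) G) =
      (chartMulSecond (E := E) G ((X : E), 0) (0, (Y : E)) - chartMulSecond (E := E) G ((Y : E), 0) (0, (X : E)) : E)
      := by
  have : IsManifold 𝓘(ℂ, E) 1 G := IsManifold.of_le (n := ω) (by simp)
  have e0 := mfderiv_extChartAt_self (I := 𝓘(ℂ, E)) (x := (1 : G))
  have e1 := Filter.EventuallyEq.lieBracket_vectorField_eq (𝕜 := ℂ)
    (mpullbackWithin_mulInvariantVectorField X) (mpullbackWithin_mulInvariantVectorField Y)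
  have hinv (T : E →L[ℂ] E) (hT : T = ContinuousLinearMap.id ℂ E) (v : E) : T.inverse v = v := by
    rw [hT, ContinuousLinearMap.inverse_id]
    rfl
  rw [GroupLieAlgebra.bracket_def, ← VectorField.mlieBracketWithin_univ,
    VectorField.mlieBracketWithin_apply]
  refine (hinv _ e0 _).trans ?_
  rw [modelWithCornersSelf_coe, Set.range_id, Set.preimage_univ, Set.univ_inter]
  refine Eq.trans ?_ (e1.trans ?_)
  · exact congrFun VectorField.lieBracketWithin_univ _
  have hW (Z : E) : fderiv ℂ (chartMul G) (chartOne G, chartOne G) (0, Z) = Z :=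
    (fderiv_chartMul_snd chartOne_mem_target Z).trans
      (mfderiv_extChartAt_one_mulInvariantVectorField extChartAt_symm_chartOne Z)
  have key (v w : E) : VectorField.lieBracket ℂ
      (fun x => fderiv ℂ (chartMul G) (x, chartOne G) (0, v))
      (fun x => fderiv ℂ (chartMul G) (x, chartOne G) (0, w)) (chartOne G) =
      chartMulSecond (E := E) G (v, 0) (0, w) - chartMulSecond (E := E) G (w, 0) (0, v) := by
    rw [VectorField.lieBracket, (hasFDerivAt_fderiv_chartMul_snd _).fderiv,
      (hasFDerivAt_fderiv_chartMul_snd _).fderiv, hW, hW]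
    rfl
  exact key X Y

/-- The differential at the identity of `g ↦ Ad g Y` is `X ↦ ⁅X, Y⁆`. -/
theorem hasFDerivAt_Ad_extChartAt_symm [CompleteSpace E] (Y : LieAlg (E := E) G) :
    ∃ A : E →L[ℂ] E, HasFDerivAt (𝕜 := ℂ) (E := E) (F := E)
      (fun x => Ad ((extChartAt 𝓘(ℂ, E) (1 : G)).symm x) Y) A (chartOne G) ∧
      ∀ X : LieAlg (E := E) G, A X = ⁅X, Y⁆ := by
  set e := extChartAt 𝓘(ℂ, E) (1 : G)
  let a : E → E := fun x => Ad (e.symm x) Y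
  let T : E → E →L[ℂ] E := fun x => (fderiv ℂ (chartMul G) (chartOne G, x)).comp
        (ContinuousLinearMap.inl ℂ E E)
  let b : E → E := fun x => fderiv ℂ (chartMul G) (x, chartOne G) (0, (Y : E))
  -- `T` and `b` represent right translation and the left-invariant vector field of `Y`, and
  -- `R_g ∘ (conjugation by g) = L_g`; so `a` solves the linear equation `T a = b`.
  have hTa : ∀ᶠ x in 𝓝 (chartOne G), T x (a x) = b x := by
    filter_upwards [target_mem_nhds_chartOne (G := G)] with x hx
    have h1 := fderiv_chartMul_fst hx (Ad (e.symm x) Y)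
    have h2 := fderiv_chartMul_snd hx Y
    rw [mfderiv_mul_right_Ad] at h1
    exact h1.trans h2.symm
  have hT1 : T (chartOne G) = 1 := fderiv_chartMul_fst_one
  have hT : HasFDerivAt T _ (chartOne G) := hasFDerivAt_fderiv_chartMul_fst
  have hb : HasFDerivAt b _ (chartOne G) := hasFDerivAt_fderiv_chartMul_snd (E := E) Y
  have hunit : ∀ᶠ x in 𝓝 (chartOne G), IsUnit (T x) := by
    refine hT.continuousAt.eventually (Units.isOpen.mem_nhds ?_)
    rw [hT1]; exact isUnit_one
  have hab : a =ᶠ[𝓝 (chartOne G)] fun x => Ring.inverse (T x) (b x) := by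
    filter_upwards [hTa, hunit] with x hx hu
    rw [← hx]
    calc a x = (Ring.inverse (T x) * T x) (a x) := by rw [Ring.inverse_mul_cancel _ hu]; rfl
      _ = _ := rfl
  have had : DifferentiableAt ℂ a (chartOne G) := by
    refine DifferentiableAt.congr_of_eventuallyEq ?_ hab
    refine DifferentiableAt.clm_apply ?_ hb.differentiableAt
    refine DifferentiableAt.comp (g := Ring.inverse) (chartOne G) ?_ hT.differentiableAt
    exact differentiableAt_inverse (by rw [hT1]; exact isUnit_one)
  refine ⟨fderiv ℂ a (chartOne G), had.hasFDerivAt, fun X => ?_⟩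
  have h1 := (hT.clm_apply had.hasFDerivAt).unique (hb.congr_of_eventuallyEq hTa)
  have h2 := congrArg (fun (S : E →L[ℂ] E) => S X) h1
  have ha1 : a (chartOne G) = Y := by
    simp only [a, e]
    rw [extChartAt_symm_chartOne, Ad_one]; rfl
  rw [hT1, ha1] at h2
  have h3 : fderiv ℂ a (chartOne G) X + chartMulSecond (E := E) G (0, (X : E)) ((Y : E), 0) =
    chartMulSecond (E := E) G ((X : E), 0) (0, (Y : E)) := h2
  rw [chartMulSecond_symm] at h3
  rw [lie_eq_chartMulSecond, ← h3, add_sub_cancel_right]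

/-- Along a curve `F` with `F⁻¹ F_z = X`, the derivative of `Ad_F Y` is `Ad_F ⁅X, Y⁆`. -/
theorem HasLeftLogDerivAt.hasDerivAt_Ad [CompleteSpace E] {F : ℂ → G} {X : LieAlg (E := E) G}
    {z : ℂ} (hF : HasLeftLogDerivAt F X z) (Y : LieAlg (E := E) G) :
    HasDerivAt (F := E) (fun w => Ad (F w) Y) (Ad (F z) ⁅X, Y⁆) z := by
  set e := extChartAt 𝓘(ℂ, E) (1 : G)
  -- Translating by `(F z)⁻¹` reduces to the derivative of `Ad` at the identity.
  let K : ℂ → G := fun w => (F z)⁻¹ * F w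
  have hK : HasLeftLogDerivAt K X z := hF.const_mul _
  have hKz : K z = 1 := by simp [K]
  have h1 : HasDerivAt (fun w => e (K w)) (X : E) z := by
    refine (hK.hasDerivAt_extChartAt (g := 1) ?_).congr_deriv ?_
    · rw [hKz]; exact mem_extChartAt_source 1
    · exact mfderiv_extChartAt_one_mulInvariantVectorField hKz X
  obtain ⟨A, hA, hAX⟩ := hasFDerivAt_Ad_extChartAt_symm (E := E) (G := G) Y
  have h2 : HasDerivAt (F := E) (fun w => Ad (e.symm (e (K w))) Y) (A X) z := by
    let a : E → E := fun x => Ad (e.symm x) Y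
    have hA' : HasFDerivAt a A (e (K z)) := by
      rw [hKz]
      exact hA
    exact hA'.comp_hasDerivAt z h1
  let D : E →L[ℂ] E := Ad (F z)
  have h3 : HasDerivAt (fun w => D (Ad (e.symm (e (K w))) Y)) (D (A X)) z :=
    D.hasFDerivAt.comp_hasDerivAt z h2
  rw [hAX] at h3
  refine HasDerivAt.congr_of_eventuallyEq (F := E) h3 ?_
  have h4 : ∀ᶠ w in 𝓝 z, K w ∈ e.source :=
    hK.1 (by rw [hKz]; exact extChartAt_source_mem_nhds 1)
  filter_upwards [h4] with w hw
  have : F w = F z * K w := by simp [K]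
  rw [e.left_inv hw, this, Ad_mul_apply]
  rfl

end Bracket

/-! ### The exponential map -/

section Exponential

variable {E : Type*} [NormedAddCommGroup E] [NormedSpace ℂ E]
  {G : Type*} [TopologicalSpace G] [ChartedSpace E G] [Group G] [LieGroup 𝓘(ℂ, E) ω G]

/-- A holomorphic integral curve of the chart representative of a left-invariant vector field gives
a curve in `G` with constant left logarithmic derivative. -/
theorem hasLeftLogDerivAt_extChartAt_symm {y : ℂ → E} {X : LieAlg (E := E) G} {z : ℂ}
    (hy : y z ∈ (extChartAt 𝓘(ℂ, E) (1 : G)).target)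
    (h : HasDerivAt y (fderiv ℂ (chartMul G) (y z, chartOne G) (0, (X : E))) z) :
    HasLeftLogDerivAt (fun w => (extChartAt 𝓘(ℂ, E) (1 : G)).symm (y w)) X z := by
  rw [fderiv_chartMul_snd hy X] at h
  have h1 := (mdifferentiableAt_extChartAt_one_symm hy).hasMFDerivAt.comp z
    h.hasFDerivAt.hasMFDerivAt
  refine h1.congr_mfderiv ?_
  refine ContinuousLinearMap.ext fun (t : ℂ) => ?_
  let D : E →L[ℂ] E := mfderiv 𝓘(ℂ, E) 𝓘(ℂ, E) (extChartAt 𝓘(ℂ, E) (1 : G)).symm (y z)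
  let V : E := mfderiv 𝓘(ℂ, E) 𝓘(ℂ, E) (extChartAt 𝓘(ℂ, E) (1 : G))
        ((extChartAt 𝓘(ℂ, E) (1 : G)).symm (y z))
        (mulInvariantVectorField X ((extChartAt 𝓘(ℂ, E) (1 : G)).symm (y z)))
  have hDV : D V = (mulInvariantVectorField X ((extChartAt 𝓘(ℂ, E) (1 : G)).symm (y z)) : E) :=
    mfderiv_extChartAt_symm_apply_mfderiv hy _
  calc _ = D (t • V) := rfl
    _ = t • D V := map_smul _ _ _
    _ = _ := by rw [hDV]; rfl

variable [CompleteSpace E]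

/-- Local one-parameter subgroups, with a bound linear in the generator: this gives both the
existence and the continuity at zero of the exponential map. -/
theorem exists_local_integralCurve :
    ∃ δ > 0, ∃ C : ℝ, ∀ X : E, ‖X‖ < δ → ∃ y : ℂ → E, y 0 = chartOne G ∧
      ∀ z ∈ Metric.ball (0 : ℂ) 2, y z ∈ (extChartAt 𝓘(ℂ, E) (1 : G)).target ∧
        HasDerivAt y (fderiv ℂ (chartMul G) (y z, chartOne G) (0, X)) z ∧
        ‖y z - chartOne G‖ ≤ C * ‖X‖ * ‖z‖ := by
  let W : E → E →L[ℂ] E := fun x => (fderiv ℂ (chartMul G) (x, chartOne G)).comp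
    (ContinuousLinearMap.inr ℂ E E)
  have hW : ContDiffAt ℂ 1 W (chartOne G) := by
    have h1 : ContDiffAt ℂ 1 (fderiv ℂ (chartMul G)) (chartOne (E := E) G, chartOne G) :=
      contDiffAt_chartMul_one.fderiv_right (m := 1) (by simp)
    have h2 : ContDiffAt ℂ 1 (fun x : E => (x, chartOne (E := E) G)) (chartOne G) :=
      contDiffAt_id.prodMk contDiffAt_const
    exact (ContDiffAt.comp (f := fun x : E => (x, chartOne (E := E) G)) (chartOne G) h1 h2).clm_comp contDiffAt_const
  obtain ⟨K, s, hs, hK⟩ := hW.exists_lipschitzOnWith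
  have hdiff : ∀ᶠ x in 𝓝 (chartOne G), DifferentiableAt ℂ W x :=
    (hW.eventually (by simp)).mono fun x hx => hx.differentiableAt (by simp)
  have hbd : ∀ᶠ x in 𝓝 (chartOne G), ‖W x‖ < ‖W (chartOne G)‖ + 1 :=
    hW.continuousAt.norm.eventually_lt_const (lt_add_one _)
  obtain ⟨a, ha, hball⟩ := Metric.eventually_nhds_iff_ball.mp
    ((hdiff.and hbd).and ((Filter.eventually_mem_set.mpr hs).and
      (Filter.eventually_mem_set.mpr (target_mem_nhds_chartOne (G := G)))))
  set C := ‖W (chartOne G)‖ + 1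
  have hC : 0 < C := by positivity
  -- The two bounds keep the curve in the ball of radius `a` up to time `2`, and make the Picard
  -- iteration a contraction there.
  refine ⟨min (a / (2 * C)) (1 / (2 * (K + 1))), by positivity, C, fun X hX => ?_⟩
  rw [lt_min_iff, lt_div_iff₀ (by positivity), lt_div_iff₀ (by positivity)] at hX
  obtain ⟨y, hy0, hy, hyb⟩ := exists_hasDerivAt_of_differentiableOn (v := fun x => W x X)
    (x₀ := chartOne G) (a := a) (r := 2) (M := C * ‖X‖) (K := K * ‖X‖₊) ha (by norm_num)
    (fun x hx => ((hball x hx).1.1.clm_apply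
      (differentiableAt_const X)).differentiableWithinAt)
    (fun x hx => ((W x).le_opNorm X).trans
      (mul_le_mul_of_nonneg_right (hball x hx).1.2.le (norm_nonneg _)))
    (by
      refine LipschitzOnWith.of_dist_le_mul fun x hx x' hx' => ?_
      have h1 := hK.dist_le_mul x (hball x hx).2.1 x' (hball x' hx').2.1
      rw [dist_eq_norm] at h1
      rw [dist_eq_norm, ← sub_apply]
      refine ((W x - W x').le_opNorm X).trans
        ((mul_le_mul_of_nonneg_right h1 (norm_nonneg _)).trans (le_of_eq ?_))
      push_cast
      ring)
    (by linarith [hX.1])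
    (by
      push_cast
      nlinarith [hX.2, norm_nonneg X])
  refine ⟨y, hy0, fun z hz => ⟨?_, hy z hz, hyb z hz⟩⟩
  refine (hball (y z) ?_).2.2
  rw [mem_ball_iff_norm]
  have h1 := hyb z hz
  rw [mem_ball_zero_iff] at hz
  nlinarith [hX.1, mul_le_mul_of_nonneg_left hz.le (mul_nonneg hC.le (norm_nonneg X))]

/-- A local one-parameter subgroup fixes its generator under `Ad`, since `⁅X, X⁆ = 0`. -/
theorem Ad_apply_self_of_hasLeftLogDerivAt {F : ℂ → G} {X : LieAlg (E := E) G} {U : Set ℂ}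
    (hU : IsOpen U) (hc : IsPreconnected U) (hF : ∀ z ∈ U, HasLeftLogDerivAt F X z) {z w : ℂ}
    (hz : z ∈ U) (hFz : F z = 1) (hw : w ∈ U) : Ad (F w) X = X := by
  have hd (u : ℂ) (hu : u ∈ U) : HasDerivAt (F := E) (fun w => Ad (F w) X) 0 u := by
    have h := (hF u hu).hasDerivAt_Ad X
    rw [lie_self, map_zero] at h
    exact h
  let a : ℂ → E := fun w => Ad (F w) X
  have h1 := hU.is_const_of_deriv_eq_zero hc (f := a)
    (fun u hu => (hd u hu).differentiableAt.differentiableWithinAt)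
    (fun u hu => (hd u hu).deriv) hw hz
  have h2 : (Ad (F w) X : E) = Ad (F z) X := h1
  rw [hFz, Ad_one] at h2
  exact h2

/-- Squaring at half the time doubles the domain of a local one-parameter subgroup. -/
theorem exists_hasLeftLogDerivAt_ball_two_mul {F : ℂ → G} {X : LieAlg (E := E) G} {r : ℝ}
    (hr : 0 < r) (hF0 : F 0 = 1) (hF : ∀ z ∈ Metric.ball (0 : ℂ) r, HasLeftLogDerivAt F X z) :
    ∃ K : ℂ → G, K 0 = 1 ∧ ∀ z ∈ Metric.ball (0 : ℂ) (2 * r), HasLeftLogDerivAt K X z := by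
  refine ⟨fun z => F (z / 2) * F (z / 2), by simp [hF0], fun z hz => ?_⟩
  have hz2 : z / 2 ∈ Metric.ball (0 : ℂ) r := by
    rw [mem_ball_zero_iff] at hz ⊢
    rw [norm_div, Complex.norm_two]
    linarith
  have h1 : HasLeftLogDerivAt (fun z => F (z / 2)) ((1 / 2 : ℂ) • X) z :=
    HasLeftLogDerivAt.comp (u := fun z => z / 2) (hF _ hz2) ((hasDerivAt_id z).div_const 2)
  have h2 := h1.mul h1
  have h3 : Ad (F (z / 2)) X = X := Ad_apply_self_of_hasLeftLogDerivAt Metric.isOpen_ball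
    (convex_ball 0 r).isPreconnected hF (Metric.mem_ball_self hr) hF0 hz2
  have h4 : Ad (F (z / 2))⁻¹ X = X := by
    conv_lhs => rw [← h3]
    exact Ad_inv_apply_Ad _ _
  rw [map_smul, h4, ← add_smul] at h2
  norm_num at h2
  exact h2

omit [CompleteSpace E] in
/-- Local one-parameter subgroups with the same generator agree. -/
theorem eqOn_ball_of_hasLeftLogDerivAt {F K : ℂ → G} {X : LieAlg (E := E) G} {r : ℝ}
    (hr : 0 < r) (hF0 : F 0 = 1) (hK0 : K 0 = 1)
    (hF : ∀ z ∈ Metric.ball (0 : ℂ) r, HasLeftLogDerivAt F X z)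
    (hK : ∀ z ∈ Metric.ball (0 : ℂ) r, HasLeftLogDerivAt K X z) :
    Set.EqOn F K (Metric.ball 0 r) := by
  intro w hw
  have h := HasLeftLogDerivAt.mul_inv_eq (X := fun _ => X) Metric.isOpen_ball
    (convex_ball 0 r).isPreconnected hF hK (Metric.mem_ball_self hr) hw
  rw [hF0, hK0, inv_one, mul_one] at h
  exact mul_inv_eq_one.mp h

theorem exists_hasLeftLogDerivAt_ball (X : LieAlg (E := E) G) (r : ℝ) :
    ∃ K : ℂ → G, K 0 = 1 ∧ ∀ z ∈ Metric.ball (0 : ℂ) r, HasLeftLogDerivAt K X z := by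
  obtain ⟨δ, hδ, C, hloc⟩ := exists_local_integralCurve (E := E) (G := G)
  let x : E := X
  have hc : 0 < δ / (‖x‖ + 1) := by positivity
  set c : ℝ := δ / (‖x‖ + 1) / 2
  have hc0 : 0 < c := by positivity
  have hcx : ‖(c : ℂ) • x‖ < δ := by
    rw [norm_smul, Complex.norm_real, Real.norm_of_nonneg hc0.le]
    have : δ / (‖x‖ + 1) * (‖x‖ + 1) = δ := div_mul_cancel₀ _ (by positivity)
    have h2 : c * 2 = δ / (‖x‖ + 1) := by simp only [c]; ring
    nlinarith [norm_nonneg x]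
  obtain ⟨y, hy0, hy⟩ := hloc _ hcx
  have hbase : ∃ K : ℂ → G, K 0 = 1 ∧
      ∀ z ∈ Metric.ball (0 : ℂ) (2 * c), HasLeftLogDerivAt K X z := by
    refine ⟨fun z => (extChartAt 𝓘(ℂ, E) (1 : G)).symm (y (z / c)), ?_, fun z hz => ?_⟩
    · simp only [zero_div, hy0]
      exact extChartAt_symm_chartOne
    · have hz2 : z / c ∈ Metric.ball (0 : ℂ) 2 := by
        rw [mem_ball_zero_iff] at hz ⊢
        rw [norm_div, Complex.norm_real, Real.norm_of_nonneg hc0.le, div_lt_iff₀ hc0]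
        exact hz
      have h1 := hasLeftLogDerivAt_extChartAt_symm (X := (c : ℂ) • X) (hy _ hz2).1 (hy _ hz2).2.1
      have h2 := HasLeftLogDerivAt.comp (u := fun z => z / (c : ℂ)) h1
        ((hasDerivAt_id z).div_const (c : ℂ))
      have hc' : (c : ℂ) ≠ 0 := by exact_mod_cast hc0.ne'
      rwa [smul_smul, one_div_mul_cancel hc', one_smul] at h2
  have hpow (n : ℕ) : ∃ K : ℂ → G, K 0 = 1 ∧
      ∀ z ∈ Metric.ball (0 : ℂ) (2 ^ n * (2 * c)), HasLeftLogDerivAt K X z := by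
    induction n with
    | zero => simpa using hbase
    | succ n ih =>
      obtain ⟨K, hK0, hK⟩ := ih
      obtain ⟨K', h0, h1⟩ := exists_hasLeftLogDerivAt_ball_two_mul (by positivity) hK0 hK
      refine ⟨K', h0, ?_⟩
      rwa [pow_succ', mul_assoc]
  obtain ⟨n, hn⟩ := pow_unbounded_of_one_lt (r / (2 * c)) (one_lt_two (α := ℝ))
  obtain ⟨K, hK0, hK⟩ := hpow n
  rw [div_lt_iff₀ (by positivity)] at hn
  exact ⟨K, hK0, fun z hz => hK z (Metric.ball_subset_ball hn.le hz)⟩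

/-- Every element of the Lie algebra generates a complex one-parameter subgroup. -/
theorem exists_isOneParam (X : LieAlg (E := E) G) : ∃ φ : ℂ → G, IsOneParam X φ := by
  choose K hK0 hK using exists_hasLeftLogDerivAt_ball (E := E) (G := G) X
  -- The local solutions on the balls of radius `‖z‖ + 1` agree where they overlap, so they glue.
  refine ⟨fun z => K (‖z‖ + 1) z, hK0 _, fun z => ?_⟩
  refine (hK (‖z‖ + 1) z (by simp)).congr ?_
  filter_upwards [Metric.isOpen_ball.mem_nhds
    (show z ∈ Metric.ball (0 : ℂ) (‖z‖ + 1) by simp)] with w hw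
  rw [mem_ball_zero_iff] at hw
  have hsub (s : ℝ) (hs : min (‖w‖ + 1) (‖z‖ + 1) ≤ s) (u : ℂ)
      (hu : u ∈ Metric.ball (0 : ℂ) (min (‖w‖ + 1) (‖z‖ + 1))) : HasLeftLogDerivAt (K s) X u :=
    hK s u (Metric.ball_subset_ball hs hu)
  exact eqOn_ball_of_hasLeftLogDerivAt (by positivity) (hK0 _) (hK0 _)
    (hsub _ (min_le_left _ _)) (hsub _ (min_le_right _ _)) (by
      rw [mem_ball_zero_iff, lt_min_iff]
      exact ⟨lt_add_one _, hw⟩)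

omit [CompleteSpace E] in
theorem IsOneParam.unique {X : LieAlg (E := E) G} {φ ψ : ℂ → G} (hφ : IsOneParam X φ)
    (hψ : IsOneParam X ψ) : φ = ψ := by
  funext z
  have h := HasLeftLogDerivAt.mul_inv_eq (X := fun _ => X) isOpen_univ isPreconnected_univ
    (fun z _ => hφ.2 z) (fun z _ => hψ.2 z) (Set.mem_univ 0) (Set.mem_univ z)
  rw [hφ.1, hψ.1, inv_one, mul_one] at h
  exact mul_inv_eq_one.mp h

omit [CompleteSpace E] in
theorem IsOneParam.lieExp_eq {X : LieAlg (E := E) G} {φ : ℂ → G} (hφ : IsOneParam X φ) :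
    lieExp X = φ 1 := by
  have h : ∃ φ : ℂ → G, IsOneParam X φ := ⟨φ, hφ⟩
  rw [lieExp, dif_pos h, h.choose_spec.unique hφ]

theorem isOneParam_lieExp (X : LieAlg (E := E) G) : IsOneParam X (fun t : ℂ => lieExp (t • X)) := by
  obtain ⟨φ, hφ⟩ := exists_isOneParam X
  have h (t : ℂ) : lieExp (t • X) = φ t := by
    have h1 : IsOneParam (t • X) (fun s : ℂ => φ (s * t)) :=
      ⟨by simp [hφ.1], fun s => HasLeftLogDerivAt.comp (u := fun s => s * t) (hφ.2 (s * t))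
        (by simpa using (hasDerivAt_id s).mul_const t)⟩
    simpa using h1.lieExp_eq
  simpa only [h] using hφ

theorem lieExp_zero : lieExp (0 : LieAlg (E := E) G) = 1 := by
  simpa using (isOneParam_lieExp (0 : LieAlg (E := E) G)).1

theorem lieExp_add_smul (s t : ℂ) (X : LieAlg (E := E) G) :
    lieExp ((s + t) • X) = lieExp (s • X) * lieExp (t • X) := by
  have h1 : IsOneParam X (fun t : ℂ => (lieExp (s • X))⁻¹ * lieExp ((s + t) • X)) := by
    refine ⟨by simp, fun t => HasLeftLogDerivAt.const_mul ?_ _⟩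
    have h := ((isOneParam_lieExp X).2 (s + t)).comp (u := fun t => s + t)
      ((hasDerivAt_id t).const_add s)
    simpa using h
  have h2 := congrFun (h1.unique (isOneParam_lieExp X)) t
  rw [← h2, mul_inv_cancel_left]

theorem lieExp_neg (X : LieAlg (E := E) G) : lieExp (-X) = (lieExp X)⁻¹ := by
  have h := lieExp_add_smul (-1) 1 X
  rw [neg_add_cancel, zero_smul, lieExp_zero, one_smul, neg_one_smul] at h
  exact eq_inv_of_mul_eq_one_left h.symm

theorem conj_lieExp (g : G) (X : LieAlg (E := E) G) :
    g * lieExp X * g⁻¹ = lieExp (Ad g X) := by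
  have h1 : IsOneParam (Ad g X) (fun t : ℂ => g * lieExp (t • X) * g⁻¹) :=
    ⟨by simp [lieExp_zero], fun t => ((isOneParam_lieExp X).2 t).conj g⟩
  simpa using h1.lieExp_eq.symm

/-- The exponential map is continuous at zero. -/
theorem tendsto_lieExp_zero :
    Filter.Tendsto (lieExp : LieAlg (E := E) G → G) (𝓝 0) (𝓝 1) := by
  obtain ⟨δ, hδ, C, hloc⟩ := exists_local_integralCurve (E := E) (G := G)
  choose! y hy0 hy using hloc
  set e := extChartAt 𝓘(ℂ, E) (1 : G)
  have h1 : ∀ X : E, ‖X‖ < δ → e.symm (y X 1) = lieExp (X : LieAlg (E := E) G) := by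
    intro X hX
    have h := eqOn_ball_of_hasLeftLogDerivAt (F := fun z => e.symm (y X z))
      (K := fun t : ℂ => lieExp (t • (X : LieAlg (E := E) G))) (X := X) (r := 2) (by norm_num)
      (by simp only [hy0 X hX]; exact extChartAt_symm_chartOne)
      (isOneParam_lieExp (E := E) (G := G) X).1
      (fun z hz => hasLeftLogDerivAt_extChartAt_symm (hy X hX z hz).1 (hy X hX z hz).2.1)
      (fun z _ => (isOneParam_lieExp (E := E) (G := G) X).2 z)
      (show (1 : ℂ) ∈ Metric.ball (0 : ℂ) 2 by simp)
    simpa using h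
  have hsmall : ∀ᶠ X : E in 𝓝 0, ‖X‖ < δ := by
    filter_upwards [Metric.ball_mem_nhds (0 : E) hδ] with X hX
    simpa using hX
  have h2 : Filter.Tendsto (fun X : E => y X 1) (𝓝 0) (𝓝 (chartOne G)) := by
    rw [tendsto_iff_norm_sub_tendsto_zero]
    have h0 : Filter.Tendsto (fun X : E => C * ‖X‖ * ‖(1 : ℂ)‖) (𝓝 0) (𝓝 0) := by
      have := ((continuous_norm (E := E)).tendsto 0).const_mul C |>.mul_const ‖(1 : ℂ)‖
      simpa using this
    refine squeeze_zero' (Filter.Eventually.of_forall fun _ => norm_nonneg _) ?_ h0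
    filter_upwards [hsmall] with X hX using (hy X hX 1 (by simp)).2.2
  have h3 : Filter.Tendsto e.symm (𝓝 (chartOne G)) (𝓝 1) := by
    have := continuousAt_extChartAt_symm (I := 𝓘(ℂ, E)) (1 : G)
    rw [ContinuousAt, extChartAt_to_inv] at this
    exact this
  refine Filter.Tendsto.congr' ?_ (h3.comp h2)
  filter_upwards [hsmall] with X hX using h1 X hX

end Exponential

/-! ### `Ad` of an exponential -/

section AdExponential

variable {E : Type*} [NormedAddCommGroup E] [NormedSpace ℂ E] [CompleteSpace E]
  {G : Type*} [TopologicalSpace G] [ChartedSpace E G] [Group G] [LieGroup 𝓘(ℂ, E) ω G]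

theorem hasDerivAt_Ad_lieExp_smul (X Z : LieAlg (E := E) G) (t : ℂ) :
    HasDerivAt (F := E) (fun t : ℂ => Ad (lieExp (t • X)) Z) (Ad (lieExp (t • X)) ⁅X, Z⁆) t :=
  ((isOneParam_lieExp X).2 t).hasDerivAt_Ad Z

/-- On an eigenvector of `ad X`, the one-parameter subgroup of `X` acts by the exponential of the
eigenvalue. -/
theorem Ad_lieExp_smul_of_lie_eq_smul {X Z : LieAlg (E := E) G} {r : ℂ} (h : ⁅X, Z⁆ = r • Z)
    (t : ℂ) : Ad (lieExp (t • X)) Z = Complex.exp (t * r) • Z := by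
  let u : ℂ → E := fun t => Ad (lieExp (t • X)) Z
  have hu (t : ℂ) : HasDerivAt u (r • u t) t := by
    have h1 := hasDerivAt_Ad_lieExp_smul X Z t
    rw [h, map_smul] at h1
    exact h1
  have hd (t : ℂ) : HasDerivAt (fun t => Complex.exp (-(t * r)) • u t) 0 t := by
    have h1 : HasDerivAt (fun t => Complex.exp (-(t * r))) (Complex.exp (-(t * r)) * -(1 * r)) t :=
      (((hasDerivAt_id t).mul_const r).neg).cexp
    refine (h1.smul (hu t)).congr_deriv ?_
    rw [smul_smul, ← add_smul, one_mul, mul_neg, add_neg_cancel, zero_smul]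
  have h2 : Complex.exp (-(t * r)) • u t = Complex.exp (-(0 * r)) • u 0 :=
    is_const_of_deriv_eq_zero (fun t => (hd t).differentiableAt) (fun t => (hd t).deriv) t 0
  have h3 : u 0 = Z := by
    simp only [u, zero_smul, lieExp_zero, Ad_one]
    rfl
  have h4 : u t = Complex.exp (t * r) • u 0 := by
    rw [zero_mul, neg_zero, Complex.exp_zero, one_smul] at h2
    rw [← h2, smul_smul, ← Complex.exp_add, add_neg_cancel, Complex.exp_zero, one_smul]
  rw [h3] at h4
  exact h4

theorem Ad_lieExp_smul_self (X : LieAlg (E := E) G) (t : ℂ) : Ad (lieExp (t • X)) X = X := by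
  rw [Ad_lieExp_smul_of_lie_eq_smul (r := 0) (by rw [lie_self, zero_smul]), mul_zero,
    Complex.exp_zero, one_smul]

/-- `Ad (exp X) = exp (ad X)`, as a Taylor series. -/
theorem hasSum_Ad_lieExp (X Z : LieAlg (E := E) G) :
    HasSum (α := E) (fun n : ℕ => ((n.factorial : ℂ)⁻¹ • ((fun W => ⁅X, W⁆)^[n] Z)))
      (Ad (lieExp X) Z) := by
  let u (Z : LieAlg (E := E) G) : ℂ → E := fun t => Ad (lieExp (t • X)) Z
  have hu (Z : LieAlg (E := E) G) : deriv (u Z) = u ⁅X, Z⁆ :=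
    funext fun t => (hasDerivAt_Ad_lieExp_smul X Z t).deriv
  have hiter (n : ℕ) : iteratedDeriv n (u Z) = u ((fun W => ⁅X, W⁆)^[n] Z) := by
    induction n with
    | zero => simp
    | succ n ih => rw [iteratedDeriv_succ, ih, hu, Function.iterate_succ_apply']
  have hd : Differentiable ℂ (u Z) := fun t => (hasDerivAt_Ad_lieExp_smul X Z t).differentiableAt
  have h := Complex.hasSum_taylorSeries_of_entire hd 0 1
  have hu0 (W : LieAlg (E := E) G) : u W 0 = W := by
    simp only [u, zero_smul, lieExp_zero, Ad_one]
    rfl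
  have hu1 : u Z 1 = Ad (lieExp X) Z := by
    simp only [u, one_smul]
    rfl
  let a : ℕ → E := fun n => (fun W : LieAlg (E := E) G => ⁅X, W⁆)^[n] Z
  have hterm (n : ℕ) : (n.factorial : ℂ)⁻¹ • (1 - 0 : ℂ) ^ n • iteratedDeriv n (u Z) 0 =
      (n.factorial : ℂ)⁻¹ • a n := by
    rw [sub_zero, one_pow, one_smul, hiter, hu0]
  rw [hu1, funext hterm] at h
  exact h

/-- `Ad (exp X) Z = Z + ⁅X, Z⁆` modulo an `ad X`-stable subspace containing `⁅X, ⁅X, Z⁆⁆`. -/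
theorem Ad_lieExp_sub_mem [FiniteDimensional ℂ E] {X Z : LieAlg (E := E) G}
    (S : Submodule ℂ (LieAlg (E := E) G)) (h : ⁅X, ⁅X, Z⁆⁆ ∈ S) (hS : ∀ W ∈ S, ⁅X, W⁆ ∈ S) :
    Ad (lieExp X) Z - (Z + ⁅X, Z⁆) ∈ S := by
  have hmem (n : ℕ) : (fun W => ⁅X, W⁆)^[n + 2] Z ∈ S := by
    induction n with
    | zero => exact h
    | succ n ih =>
      rw [show n + 1 + 2 = (n + 2) + 1 by ring, Function.iterate_succ_apply']
      exact hS _ ih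
  have key (T : Submodule ℂ E) (f : ℕ → E) (x : E) (hf : HasSum f x) (hT : ∀ n, f (n + 2) ∈ T) :
      x - (f 0 + f 1) ∈ T := by
    have h1 := (hasSum_nat_add_iff' 2).mpr hf
    rw [Finset.sum_range_succ, Finset.sum_range_one] at h1
    exact T.closed_of_finiteDimensional.mem_of_tendsto h1
      (Filter.Eventually.of_forall fun s => T.sum_mem fun n _ => hT n)
  have h01 : Z + ⁅X, Z⁆ = (Nat.factorial 0 : ℂ)⁻¹ • ((fun W => ⁅X, W⁆)^[0] Z) +
      (Nat.factorial 1 : ℂ)⁻¹ • ((fun W => ⁅X, W⁆)^[1] Z) := by simp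
  rw [h01]
  exact key S _ _ (hasSum_Ad_lieExp X Z) (fun n => S.smul_mem _ (hmem n))

end AdExponential

/-! ### The filtration of `𝔫₋` by the values of roots on `w₀` -/

section NilpotentFiltration

variable {L : Type*} [LieRing L] [LieAlgebra ℂ L] [FiniteDimensional ℂ L]
  [LieAlgebra.IsKilling ℂ L] {H : LieSubalgebra ℂ L} [H.IsCartanSubalgebra]
  {b : (LieAlgebra.IsKilling.rootSystem H).Base} {γ : b.support → ℝ}

/-- Positive roots take positive real values on `w₀`. -/
theorem exists_pos_root_w₀_eq (hγ : ∀ i, -1 < γ i) {α : H.root} (hα : b.IsPos α) :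
    ∃ r : ℝ, 0 < r ∧ α.1 (w₀ b γ) = r := by
  refine hα.induction_on_add (p := fun α : H.root => ∃ r : ℝ, 0 < r ∧ α.1 (w₀ b γ) = r) ?_ ?_
  · intro i hi
    exact ⟨γ ⟨i, hi⟩ + 1, by linarith [hγ ⟨i, hi⟩], root_w₀ b γ ⟨i, hi⟩⟩
  · rintro i j k hk ⟨r, hr, hi⟩ hj
    refine ⟨r + (γ ⟨j, hj⟩ + 1), by linarith [hγ ⟨j, hj⟩], ?_⟩
    have h1 := LinearMap.congr_fun hk (w₀ b γ)
    have h2 := root_w₀ b γ ⟨j, hj⟩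
    simp only [LieAlgebra.IsKilling.rootSystem_root_apply, LinearMap.add_apply,
      LieModule.Weight.toLinear_apply] at h1
    rw [h1, hi, h2]
    push_cast
    ring

theorem negRoot_apply (α : H.root) (h : H) : (negRoot α).1 h = -α.1 h := by
  simp [negRoot]

theorem lie_eq_neg_smul_of_mem_rootSpace_negRoot {α : H.root} {x : L}
    (hx : x ∈ LieAlgebra.rootSpace H (negRoot α).1) (h : H) : ⁅(h : L), x⁆ = -α.1 h • x := by
  rw [← negRoot_apply]
  exact LieAlgebra.IsKilling.lie_eq_smul_of_mem_rootSpace hx h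

variable (b γ) in
/-- The sum of the root spaces `𝔤_{-α}` over the positive roots `α` with `α(w₀) ≥ a`. These
submodules form a decreasing filtration of `𝔫₋`. -/
def nMinusGE (a : ℝ) : Submodule ℂ L :=
  ⨆ (α : H.root) (_ : b.IsPos α ∧ a ≤ (α.1 (w₀ b γ)).re),
    (LieAlgebra.rootSpace H (negRoot α).1).toSubmodule

theorem mem_nMinusGE {a : ℝ} {α : H.root} (hα : b.IsPos α) (ha : a ≤ (α.1 (w₀ b γ)).re) {x : L}
    (hx : x ∈ LieAlgebra.rootSpace H (negRoot α).1) : x ∈ nMinusGE b γ a :=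
  le_iSup₂_of_le (f := fun (α : H.root) (_ : b.IsPos α ∧ a ≤ (α.1 (w₀ b γ)).re) =>
    (LieAlgebra.rootSpace H (negRoot α).1).toSubmodule) α ⟨hα, ha⟩ le_rfl hx

theorem mem_nMinus {α : H.root} (hα : b.IsPos α) {x : L}
    (hx : x ∈ LieAlgebra.rootSpace H (negRoot α).1) : x ∈ nMinus b :=
  le_iSup₂_of_le (f := fun (α : H.root) (_ : b.IsPos α) =>
    (LieAlgebra.rootSpace H (negRoot α).1).toSubmodule) α hα le_rfl hx

theorem nMinusGE_induction {a : ℝ} {p : L → Prop} (hp0 : p 0) (hadd : ∀ x y, p x → p y → p (x + y))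
    (hroot : ∀ α : H.root, b.IsPos α → a ≤ (α.1 (w₀ b γ)).re →
      ∀ x ∈ LieAlgebra.rootSpace H (negRoot α).1, p x) {x : L} (hx : x ∈ nMinusGE b γ a) : p x := by
  rw [nMinusGE, iSup_subtype' (p := fun α : H.root => b.IsPos α ∧ a ≤ (α.1 (w₀ b γ)).re)] at hx
  exact Submodule.iSup_induction _ (motive := p) hx (fun α y hy => hroot α.1 α.2.1 α.2.2 y hy) hp0 hadd

theorem nMinus_induction {p : L → Prop} (hp0 : p 0) (hadd : ∀ x y, p x → p y → p (x + y))
    (hroot : ∀ α : H.root, b.IsPos α →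
      ∀ x ∈ LieAlgebra.rootSpace H (negRoot α).1, p x) {x : L} (hx : x ∈ nMinus b) : p x := by
  rw [nMinus, iSup_subtype' (p := fun α : H.root => b.IsPos α)] at hx
  exact Submodule.iSup_induction _ (motive := p) hx (fun α y hy => hroot α.1 α.2 y hy) hp0 hadd

theorem nMinusGE_le_nMinus (a : ℝ) : nMinusGE b γ a ≤ nMinus b := fun _ hx =>
  nMinusGE_induction (zero_mem _) (fun _ _ => add_mem) (fun _ hα _ _ hx => mem_nMinus hα hx) hx

theorem nMinusGE_anti {a a' : ℝ} (h : a ≤ a') : nMinusGE b γ a' ≤ nMinusGE b γ a := fun _ hx =>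
  nMinusGE_induction (zero_mem _) (fun _ _ => add_mem)
    (fun _ hα ha _ hx => mem_nMinusGE hα (h.trans ha) hx) hx

/-- There are finitely many positive roots, so their values on `w₀` are bounded below by some
`m > 0`. -/
theorem exists_nMinus_le_nMinusGE (hγ : ∀ i, -1 < γ i) :
    ∃ m : ℝ, 0 < m ∧ nMinus b ≤ nMinusGE b γ m := by
  have h1 (α : H.root) : ∃ r : ℝ, 0 < r ∧ (b.IsPos α → r ≤ (α.1 (w₀ b γ)).re) := by
    by_cases hα : b.IsPos α
    · obtain ⟨r, hr, h⟩ := exists_pos_root_w₀_eq hγ hα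
      exact ⟨r, hr, fun _ => by rw [h, Complex.ofReal_re]⟩
    · exact ⟨1, one_pos, fun h => absurd h hα⟩
  choose r hr hrα using h1
  obtain ⟨m, hm, hmr⟩ : ∃ m : ℝ, 0 < m ∧ ∀ α, m ≤ r α := by
    rcases isEmpty_or_nonempty H.root with _ | _
    · exact ⟨1, one_pos, fun α => isEmptyElim α⟩
    · obtain ⟨α₀, h0⟩ := Finite.exists_min r
      exact ⟨r α₀, hr α₀, h0⟩
  exact ⟨m, hm, fun _ hx => nMinus_induction (zero_mem _) (fun _ _ => add_mem)
    (fun α hα _ hx => mem_nMinusGE hα ((hmr α).trans (hrα α hα)) hx) hx⟩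

variable (b γ) in
theorem exists_nMinusGE_eq_bot : ∃ A : ℝ, ∀ a, A < a → nMinusGE b γ a = ⊥ := by
  obtain ⟨A, hA⟩ := (Set.finite_range fun α : H.root => (α.1 (w₀ b γ)).re).bddAbove
  refine ⟨A, fun a ha => eq_bot_iff.mpr fun x hx => ?_⟩
  refine nMinusGE_induction (p := fun x => x ∈ (⊥ : Submodule ℂ L)) (zero_mem _)
    (fun _ _ => add_mem) (fun α _ h _ _ => ?_) hx
  exact absurd (hA ⟨α, rfl⟩) (not_le.mpr (ha.trans_le h))

theorem lie_mem_nMinusGE_add {a a' : ℝ} {x y : L} (hγ : ∀ i, -1 < γ i) (hx : x ∈ nMinusGE b γ a)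
    (hy : y ∈ nMinusGE b γ a') : ⁅x, y⁆ ∈ nMinusGE b γ (a + a') := by
  refine nMinusGE_induction (p := fun x => ⁅x, y⁆ ∈ nMinusGE b γ (a + a')) (by simp)
    (fun _ _ h h' => by rw [add_lie]; exact add_mem h h') (fun α hα ha x hx => ?_) hx
  refine nMinusGE_induction (p := fun y => ⁅x, y⁆ ∈ nMinusGE b γ (a + a')) (by simp)
    (fun _ _ h h' => by rw [lie_add]; exact add_mem h h') (fun β hβ hb y hy => ?_) hy
  have h1 := LieAlgebra.lie_mem_genWeightSpace_of_mem_genWeightSpace hx hy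
  by_cases hbot : LieModule.genWeightSpace L ((negRoot α).1 + (negRoot β).1 : H → ℂ) = ⊥
  · rw [hbot, LieSubmodule.mem_bot] at h1
    rw [h1]
    exact zero_mem _
  obtain ⟨r, hr, hαr⟩ := exists_pos_root_w₀_eq hγ hα
  obtain ⟨s, hs, hβs⟩ := exists_pos_root_w₀_eq hγ hβ
  let χ : LieModule.Weight ℂ H L := ⟨_, hbot⟩
  have hχ (h : H) : χ h = -(α.1 h + β.1 h) := by
    change (negRoot α).1 h + (negRoot β).1 h = _
    rw [negRoot_apply, negRoot_apply]
    ring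
  have hχ0 : χ.IsNonZero := by
    intro h0
    have h2 := congrFun h0 (w₀ b γ)
    rw [hχ, hαr, hβs, Pi.zero_apply, ← Complex.ofReal_add, ← Complex.ofReal_neg,
      Complex.ofReal_eq_zero] at h2
    linarith
  let δ' : H.root := ⟨χ, by simpa using hχ0⟩
  let δ : H.root := negRoot δ'
  have hδ (h : H) : δ.1 h = α.1 h + β.1 h := by
    rw [negRoot_apply, show δ'.1 = χ from rfl, hχ, neg_neg]
  have hδpos : b.IsPos δ := hα.add hβ (LinearMap.ext fun h => hδ h)
  refine mem_nMinusGE hδpos ?_ ?_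
  · rw [hδ, Complex.add_re]
    linarith
  · have : ((negRoot δ).1 : H → ℂ) = (negRoot α).1 + (negRoot β).1 := by
      funext h
      rw [negRoot_apply, hδ, Pi.add_apply, negRoot_apply, negRoot_apply]
      ring
    rw [LieAlgebra.rootSpace, this]
    exact h1

/-- `ad w₀` is invertible on each step of the filtration. -/
theorem exists_lie_w₀_eq (hγ : ∀ i, -1 < γ i) {a : ℝ} {y : L} (hy : y ∈ nMinusGE b γ a) :
    ∃ x ∈ nMinusGE b γ a, ⁅(w₀ b γ : L), x⁆ = y := by
  refine nMinusGE_induction (p := fun y => ∃ x ∈ nMinusGE b γ a, ⁅(w₀ b γ : L), x⁆ = y)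
    ⟨0, zero_mem _, lie_zero _⟩ ?_ (fun α hα ha y hy => ?_) hy
  · rintro _ _ ⟨x, hx, rfl⟩ ⟨x', hx', rfl⟩
    exact ⟨x + x', add_mem hx hx', lie_add _ _ _⟩
  · obtain ⟨r, hr, hαr⟩ := exists_pos_root_w₀_eq hγ hα
    have hr0 : (r : ℂ) ≠ 0 := by exact_mod_cast hr.ne'
    refine ⟨-((r : ℂ)⁻¹ • y), neg_mem (Submodule.smul_mem _ _ (mem_nMinusGE hα ha hy)), ?_⟩
    rw [lie_neg, lie_smul, lie_eq_neg_smul_of_mem_rootSpace_negRoot hy, hαr, neg_smul, smul_neg,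
      neg_neg, smul_smul, inv_mul_cancel₀ hr0, one_smul]

theorem principalF_mem_nMinus (c : ChevalleyBasis H) : principalF b c ∈ nMinus b :=
  Submodule.sum_mem _ fun i _ =>
    mem_nMinus (RootPairing.Base.isPos_of_mem_support i.2) (c.e_mem (negRoot i.1))

end NilpotentFiltration

/-! ### The action of `N₋` on `w₀ + 𝔫₋` -/

section Unipotent

variable {E : Type*} [NormedAddCommGroup E] [NormedSpace ℂ E] [FiniteDimensional ℂ E]
  [CompleteSpace E]
  {G : Type*} [TopologicalSpace G] [ChartedSpace E G] [Group G] [LieGroup 𝓘(ℂ, E) ω G]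
  [LieAlgebra.IsSimple ℂ (LieAlg (E := E) G)]
  {H : LieSubalgebra ℂ (LieAlg (E := E) G)} [H.IsCartanSubalgebra]
  {b : (LieAlgebra.IsKilling.rootSystem H).Base} {γ : b.support → ℝ}

theorem lieExp_mem_NMinus {X : LieAlg (E := E) G} (hX : X ∈ nMinus b) : lieExp X ∈ NMinus b :=
  Subgroup.subset_closure ⟨X, hX, rfl⟩

theorem Ad_lieExp_cartan_of_mem_rootSpace {α : H.root} {X : LieAlg (E := E) G}
    (hX : X ∈ LieAlgebra.rootSpace H (negRoot α).1) (h : H) (t : ℂ) :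
    Ad (lieExp (t • (h : LieAlg (E := E) G))) X = Complex.exp (-(t * α.1 h)) • X := by
  rw [Ad_lieExp_smul_of_lie_eq_smul (lie_eq_neg_smul_of_mem_rootSpace_negRoot hX h), mul_neg]

theorem Ad_lieExp_cartan_mem_nMinus {X : LieAlg (E := E) G} (hX : X ∈ nMinus b) (h : H) (t : ℂ) :
    Ad (lieExp (t • (h : LieAlg (E := E) G))) X ∈ nMinus b := by
  refine nMinus_induction
    (p := fun X => Ad (lieExp (t • (h : LieAlg (E := E) G))) X ∈ nMinus b) ?_ ?_ ?_ hX
  · rw [map_zero]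
    exact zero_mem _
  · intro x y hx hy
    rw [map_add]
    exact add_mem hx hy
  · intro α hα x hx
    rw [Ad_lieExp_cartan_of_mem_rootSpace hx]
    exact Submodule.smul_mem _ _ (mem_nMinus hα hx)

/-- `N₋` is normalised by the torus. -/
theorem conj_lieExp_cartan_mem_NMinus {g : G} (hg : g ∈ NMinus b) (h : H) (t : ℂ) :
    lieExp (t • (h : LieAlg (E := E) G)) * g * (lieExp (t • (h : LieAlg (E := E) G)))⁻¹ ∈
      NMinus b := by
  refine Subgroup.closure_induction (p := fun g _ => lieExp (t • (h : LieAlg (E := E) G)) * g *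
    (lieExp (t • (h : LieAlg (E := E) G)))⁻¹ ∈ NMinus b) ?_ ?_ ?_ ?_ hg
  · rintro _ ⟨X, hX, rfl⟩
    rw [conj_lieExp]
    exact lieExp_mem_NMinus (Ad_lieExp_cartan_mem_nMinus hX h t)
  · simp [one_mem]
  · intro x y _ _ hx hy
    rw [← conj_mul]
    exact mul_mem hx hy
  · intro x _ hx
    rw [← conj_inv]
    exact inv_mem hx

/-- As `Re t → ∞`, `exp (t w₀)` contracts `𝔫₋` to zero. -/
theorem tendsto_Ad_lieExp_w₀ (hγ : ∀ i, -1 < γ i) {X : LieAlg (E := E) G} (hX : X ∈ nMinus b) :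
    Filter.Tendsto (fun t : ℂ => Ad (lieExp (t • (w₀ b γ : LieAlg (E := E) G))) X)
      (Filter.comap Complex.re Filter.atTop) (𝓝 0) := by
  refine nMinus_induction (p := fun X => Filter.Tendsto
    (fun t : ℂ => Ad (lieExp (t • (w₀ b γ : LieAlg (E := E) G))) X)
      (Filter.comap Complex.re Filter.atTop) (𝓝 0)) ?_ ?_ ?_ hX
  · simp only [map_zero]
    exact tendsto_const_nhds
  · intro x y hx hy
    simpa only [map_add, add_zero] using hx.add hy
  · intro α hα x hx
    obtain ⟨r, hr, hαr⟩ := exists_pos_root_w₀_eq hγ hα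
    simp only [Ad_lieExp_cartan_of_mem_rootSpace hx, hαr]
    have h1 : Filter.Tendsto (fun t : ℂ => Complex.exp (-(t * r)))
        (Filter.comap Complex.re Filter.atTop) (𝓝 0) := by
      rw [tendsto_zero_iff_norm_tendsto_zero]
      have h2 (t : ℂ) : ‖Complex.exp (-(t * r))‖ = Real.exp (-(t.re * r)) := by
        rw [Complex.norm_exp, Complex.neg_re, Complex.re_mul_ofReal]
      simp only [h2]
      exact Real.tendsto_exp_neg_atTop_nhds_zero.comp
        (Filter.tendsto_comap.atTop_mul_const hr)
    simpa only [zero_smul] using h1.smul_const x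

/-- As `Re t → ∞`, conjugation by `exp (t w₀)` contracts `N₋` to the identity. -/
theorem tendsto_conj_lieExp_w₀ (hγ : ∀ i, -1 < γ i) {g : G} (hg : g ∈ NMinus b) :
    Filter.Tendsto (fun t : ℂ => lieExp (t • (w₀ b γ : LieAlg (E := E) G)) * g *
      (lieExp (t • (w₀ b γ : LieAlg (E := E) G)))⁻¹)
      (Filter.comap Complex.re Filter.atTop) (𝓝 1) := by
  have : IsTopologicalGroup G := topologicalGroup_of_lieGroup 𝓘(ℂ, E) ω
  refine Subgroup.closure_induction (p := fun g _ => Filter.Tendsto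
    (fun t : ℂ => lieExp (t • (w₀ b γ : LieAlg (E := E) G)) * g *
      (lieExp (t • (w₀ b γ : LieAlg (E := E) G)))⁻¹)
      (Filter.comap Complex.re Filter.atTop) (𝓝 1)) ?_ ?_ ?_ ?_ hg
  · rintro _ ⟨X, hX, rfl⟩
    simp only [conj_lieExp]
    exact tendsto_lieExp_zero.comp (tendsto_Ad_lieExp_w₀ hγ hX)
  · simpa using tendsto_const_nhds
  · intro x y _ _ hx hy
    simp only [← conj_mul]
    simpa using hx.mul hy
  · intro x _ hx
    simp only [← conj_inv]
    simpa using hx.inv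

/-- The stabiliser of `w₀` in `N₋` is trivial: an element fixing `w₀` commutes with `exp (t w₀)`,
while conjugation by `exp (t w₀)` contracts it to the identity. -/
theorem eq_one_of_Ad_w₀_eq [T2Space G] (hγ : ∀ i, -1 < γ i) {g : G} (hg : g ∈ NMinus b)
    (h : Ad g (w₀ b γ : LieAlg (E := E) G) = w₀ b γ) : g = 1 := by
  have hcomm (t : ℂ) : lieExp (t • (w₀ b γ : LieAlg (E := E) G)) * g *
      (lieExp (t • (w₀ b γ : LieAlg (E := E) G)))⁻¹ = g := by
    have h1 := conj_lieExp g (t • (w₀ b γ : LieAlg (E := E) G))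
    rw [map_smul, h] at h1
    rw [← mul_inv_eq_iff_eq_mul.mp h1, mul_inv_cancel_right]
  have h2 := tendsto_conj_lieExp_w₀ hγ hg
  simp only [hcomm] at h2
  have : (Filter.comap Complex.re Filter.atTop).NeBot :=
    Filter.atTop_neBot.comap_of_surj Complex.re_surjective
  exact tendsto_nhds_unique tendsto_const_nhds h2

theorem eq_of_Ad_inv_w₀_eq [T2Space G] (hγ : ∀ i, -1 < γ i) {g g' : G} (hg : g ∈ NMinus b)
    (hg' : g' ∈ NMinus b)
    (h : Ad g⁻¹ (w₀ b γ : LieAlg (E := E) G) = Ad g'⁻¹ (w₀ b γ : LieAlg (E := E) G)) :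
    g = g' := by
  have h1 : g' * g⁻¹ = 1 := by
    refine eq_one_of_Ad_w₀_eq hγ (mul_mem hg' (inv_mem hg)) ?_
    rw [Ad_mul_apply, h, Ad_apply_Ad_inv]
  exact (mul_inv_eq_one.mp h1).symm

/-- `N₋` acts transitively on `w₀ + 𝔫₋`: the component of `Y` of lowest height is removed by an
element `exp X` with `⁅w₀, X⁆ = Y`, up to terms deeper in the filtration. -/
theorem exists_Ad_w₀_add_eq (hγ : ∀ i, -1 < γ i) {Y : LieAlg (E := E) G} (hY : Y ∈ nMinus b) :
    ∃ g ∈ NMinus b, Ad g ((w₀ b γ : LieAlg (E := E) G) + Y) = (w₀ b γ : LieAlg (E := E) G) := by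
  obtain ⟨m, hm, hle⟩ := exists_nMinus_le_nMinusGE (b := b) hγ
  obtain ⟨A, hA⟩ := exists_nMinusGE_eq_bot b γ
  have key (n : ℕ) : ∀ a : ℝ, m ≤ a → A < a + n * m → ∀ Y ∈ nMinusGE b γ a,
      ∃ g ∈ NMinus b, Ad g ((w₀ b γ : LieAlg (E := E) G) + Y) = (w₀ b γ : LieAlg (E := E) G) := by
    induction n with
    | zero =>
      intro a _ ha Y hY
      rw [hA a (by simpa using ha), Submodule.mem_bot] at hY
      refine ⟨1, one_mem _, ?_⟩
      rw [hY, add_zero, Ad_one]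
      rfl
    | succ n ih =>
      intro a hma ha Y hY
      obtain ⟨X, hX, hXY⟩ := exists_lie_w₀_eq hγ hY
      have hXw : ⁅X, (w₀ b γ : LieAlg (E := E) G)⁆ = -Y := by rw [← lie_skew, hXY]
      have hmono : nMinusGE b γ (a + a) ≤ nMinusGE b γ (a + m) := nMinusGE_anti (by linarith)
      have hXZ : ⁅X, (w₀ b γ : LieAlg (E := E) G) + Y⁆ = -Y + ⁅X, Y⁆ := by rw [lie_add, hXw]
      have hstab (W : LieAlg (E := E) G) (hW : W ∈ nMinusGE b γ (a + m)) :
          ⁅X, W⁆ ∈ nMinusGE b γ (a + m) :=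
        nMinusGE_anti (by linarith) (lie_mem_nMinusGE_add hγ hX hW)
      have hXYmem : ⁅X, Y⁆ ∈ nMinusGE b γ (a + m) := hmono (lie_mem_nMinusGE_add hγ hX hY)
      have h1 := Ad_lieExp_sub_mem (X := X) (Z := (w₀ b γ : LieAlg (E := E) G) + Y)
        (nMinusGE b γ (a + m))
        (by
          rw [hXZ, lie_add, lie_neg]
          exact add_mem (neg_mem hXYmem) (hstab _ hXYmem)) hstab
      have h2 : Ad (lieExp X) ((w₀ b γ : LieAlg (E := E) G) + Y) - (w₀ b γ : LieAlg (E := E) G) ∈ nMinusGE b γ (a + m) := by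
        have h3 := add_mem h1 hXYmem
        rw [hXZ] at h3
        convert h3 using 1
        abel
      obtain ⟨g, hg, hgw⟩ := ih (a + m) (by linarith) (by push_cast at ha; linarith) _ h2
      refine ⟨g * lieExp X, mul_mem hg (lieExp_mem_NMinus (nMinusGE_le_nMinus _ hX)), ?_⟩
      rw [Ad_mul_apply]
      rwa [add_sub_cancel] at hgw
  obtain ⟨n, hn⟩ := exists_nat_gt ((A - m) / m)
  rw [div_lt_iff₀ hm] at hn
  exact key n m le_rfl (by linarith) Y (hle hY)

end Unipotent

/-! ### The solution of the Toda equation -/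

section Solution

variable {E : Type*} [NormedAddCommGroup E] [NormedSpace ℂ E] [FiniteDimensional ℂ E]
  [CompleteSpace E]
  {G : Type*} [TopologicalSpace G] [ChartedSpace E G] [Group G] [LieGroup 𝓘(ℂ, E) ω G]
  [LieAlgebra.IsSimple ℂ (LieAlg (E := E) G)]
  {H : LieSubalgebra ℂ (LieAlg (E := E) G)} [H.IsCartanSubalgebra]
  {b : (LieAlgebra.IsKilling.rootSystem H).Base} {γ : b.support → ℝ}

theorem Q_eq (z : ℂ) : (Q b γ z : G) = lieExp (Complex.log z • (w₀ b γ : LieAlg (E := E) G)) := by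
  rw [Q, w₀]
  congr 1
  rw [AddSubmonoidClass.coe_finsetSum, Finset.smul_sum]
  refine Finset.sum_congr rfl fun j _ => ?_
  rw [SetLike.val_smul, smul_smul, mul_comm]

theorem Q_inv_eq (z : ℂ) :
    (Q b γ z : G)⁻¹ = lieExp ((-Complex.log z) • (w₀ b γ : LieAlg (E := E) G)) := by
  rw [Q_eq, neg_smul, lieExp_neg]

theorem Ad_lieExp_neg_log_e (c : ChevalleyBasis H) (i : b.support) {z : ℂ} (hz : z ≠ 0) :
    Ad (lieExp ((-Complex.log z) • (w₀ b γ : LieAlg (E := E) G))) (c.e (negRoot i.1)) =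
      (z ^ ((γ i + 1 : ℝ) : ℂ)) • c.e (negRoot i.1) := by
  rw [Ad_lieExp_cartan_of_mem_rootSpace (c.e_mem _), root_w₀, Complex.cpow_def_of_ne_zero hz]
  congr 2
  ring

theorem Ad_Q_inv_principalF (c : ChevalleyBasis H) {z : ℂ} (hz : z ≠ 0) :
    Ad (Q b γ z : G)⁻¹ (principalF b c) = xi b c γ z := by
  rw [Q_inv_eq, principalF, xi, map_sum]
  exact Finset.sum_congr rfl fun i _ => Ad_lieExp_neg_log_e c i hz

theorem xi_eq_smul_zeta (c : ChevalleyBasis H) {z : ℂ} (hz : z ≠ 0) :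
    xi b c γ z = z • zeta b c γ z := by
  rw [xi, zeta, Finset.smul_sum]
  refine Finset.sum_congr rfl fun i _ => ?_
  rw [smul_smul]
  congr 1
  push_cast
  rw [Complex.cpow_add _ _ hz, Complex.cpow_one, mul_comm]

theorem hasLeftLogDerivAt_Q {z : ℂ} (hz : z ∈ Complex.slitPlane) :
    HasLeftLogDerivAt (fun z => (Q b γ z : G)) (z⁻¹ • (w₀ b γ : LieAlg (E := E) G)) z := by
  simp only [Q_eq]
  exact HasLeftLogDerivAt.comp ((isOneParam_lieExp (w₀ b γ : LieAlg (E := E) G)).2 _)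
    (Complex.hasDerivAt_log hz)

theorem Ad_Q_inv_w₀ (z : ℂ) :
    Ad (Q b γ z : G)⁻¹ (w₀ b γ : LieAlg (E := E) G) = w₀ b γ := by
  rw [Q_inv_eq, Ad_lieExp_smul_self]

theorem Ad_Q_w₀ (z : ℂ) :
    Ad (Q b γ z : G) (w₀ b γ : LieAlg (E := E) G) = w₀ b γ := by
  rw [Q_eq, Ad_lieExp_smul_self]

/-- The conjugate of `ψ` by the torus solves the Toda equation. -/
theorem hasLeftLogDerivAt_conj_Q (c : ChevalleyBasis H) {ψ : G}
    (hψ : Ad ψ⁻¹ (w₀ b γ : LieAlg (E := E) G) = (w₀ b γ : LieAlg (E := E) G) - principalF b c)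
    {z : ℂ} (hz : z ∈ Complex.slitPlane) :
    HasLeftLogDerivAt (fun z => (Q b γ z)⁻¹ * ψ * Q b γ z) (zeta b c γ z) z := by
  have hz0 : z ≠ 0 := Complex.slitPlane_ne_zero hz
  have hQ := hasLeftLogDerivAt_Q (b := b) (γ := γ) hz
  have h := (hQ.inv.mul (hasLeftLogDerivAt_const ψ z)).mul hQ
  convert h using 1
  rw [map_smul, Ad_Q_w₀, add_zero, map_neg, map_smul, hψ, map_neg, map_smul, map_sub, Ad_Q_inv_w₀,
    Ad_Q_inv_principalF c hz0, xi_eq_smul_zeta c hz0, smul_sub, smul_smul, inv_mul_cancel₀ hz0,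
    one_smul]
  abel

theorem tendsto_neg_log_re :
    Filter.Tendsto (fun z : ℂ => -Complex.log z) (𝓝[Complex.slitPlane] 0)
      (Filter.comap Complex.re Filter.atTop) := by
  rw [Filter.tendsto_comap_iff]
  have h1 : Complex.re ∘ (fun z : ℂ => -Complex.log z) = fun z => -Real.log ‖z‖ := by
    funext z
    simp [Complex.log_re]
  rw [h1]
  refine Filter.tendsto_neg_atBot_atTop.comp (Real.tendsto_log_nhdsNE_zero.comp ?_)
  refine tendsto_nhdsWithin_iff.mpr ⟨?_, ?_⟩
  · have := (continuous_norm (E := ℂ)).tendsto 0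
    rw [norm_zero] at this
    exact this.mono_left nhdsWithin_le_nhds
  · filter_upwards [self_mem_nhdsWithin] with z hz
    simpa using Complex.slitPlane_ne_zero hz

theorem isPreconnected_slitPlane : IsPreconnected Complex.slitPlane :=
  (Complex.starConvex_one_slitPlane.isPathConnected
    Complex.one_mem_slitPlane).isConnected.isPreconnected

theorem zero_mem_closure_slitPlane : (0 : ℂ) ∈ closure Complex.slitPlane := by
  have h : Filter.Tendsto (fun x : ℝ => (x : ℂ)) (𝓝[>] 0) (𝓝 0) :=
    (Complex.continuous_ofReal.tendsto' 0 0 Complex.ofReal_zero).mono_left nhdsWithin_le_nhds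
  refine mem_closure_of_tendsto h ?_
  filter_upwards [self_mem_nhdsWithin] with x hx
  exact Complex.ofReal_mem_slitPlane.mpr hx

/-- Uniqueness of the solution: two solutions differ by a constant left factor, which the limit at
`0` determines. -/
theorem IsTodaSolution.eqOn [T2Space G] {c : ChevalleyBasis H} {Φ Φ' : ℂ → G}
    (h : IsTodaSolution b c γ Φ) (h' : IsTodaSolution b c γ Φ') :
    Set.EqOn Φ' Φ Complex.slitPlane := by
  intro z hz
  have : IsTopologicalGroup G := topologicalGroup_of_lieGroup 𝓘(ℂ, E) ω
  have : (𝓝[Complex.slitPlane] (0 : ℂ)).NeBot :=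
    mem_closure_iff_nhdsWithin_neBot.mp zero_mem_closure_slitPlane
  have h1 : Filter.Tendsto (fun w => Φ' w * (Φ w)⁻¹) (𝓝[Complex.slitPlane] 0) (𝓝 1) := by
    simpa using h'.2.mul h.2.inv
  have h2 : Filter.Tendsto (fun w => Φ' w * (Φ w)⁻¹) (𝓝[Complex.slitPlane] 0)
      (𝓝 (Φ' z * (Φ z)⁻¹)) := by
    refine tendsto_const_nhds.congr' ?_
    filter_upwards [self_mem_nhdsWithin] with w hw
    exact HasLeftLogDerivAt.mul_inv_eq Complex.isOpen_slitPlane isPreconnected_slitPlane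
      (fun u hu => (h'.1 u hu).2) (fun u hu => (h.1 u hu).2) hw hz
  exact mul_inv_eq_one.mp (tendsto_nhds_unique h2 h1)

theorem conj_Q_mem_NMinus {ψ : G} (hψ : ψ ∈ NMinus b) (z : ℂ) :
    (Q b γ z)⁻¹ * ψ * Q b γ z ∈ NMinus b := by
  have h := conj_lieExp_cartan_mem_NMinus hψ (w₀ b γ) (-Complex.log z)
  rwa [← Q_inv_eq, inv_inv] at h

theorem isConjugator_conj_Q {c : ChevalleyBasis H} {ψ : G} (hψN : ψ ∈ NMinus b)
    (hψ : Ad ψ⁻¹ (w₀ b γ : LieAlg (E := E) G) = (w₀ b γ : LieAlg (E := E) G) - principalF b c) :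
    IsConjugator b c γ (fun z => (Q b γ z)⁻¹ * ψ * Q b γ z) := by
  refine fun z hz => ⟨conj_Q_mem_NMinus hψN z, ?_⟩
  rw [show ((Q b γ z)⁻¹ * ψ * Q b γ z)⁻¹ = (Q b γ z)⁻¹ * (ψ⁻¹ * Q b γ z) by group,
    Ad_mul_apply, Ad_mul_apply, Ad_Q_w₀, hψ, map_sub, Ad_Q_inv_w₀,
    Ad_Q_inv_principalF c (Complex.slitPlane_ne_zero hz)]

theorem isTodaSolution_conj_Q (hγ : ∀ i, -1 < γ i) {c : ChevalleyBasis H} {ψ : G}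
    (hψN : ψ ∈ NMinus b)
    (hψ : Ad ψ⁻¹ (w₀ b γ : LieAlg (E := E) G) = (w₀ b γ : LieAlg (E := E) G) - principalF b c) :
    IsTodaSolution b c γ (fun z => (Q b γ z)⁻¹ * ψ * Q b γ z) := by
  refine ⟨fun z hz => ⟨conj_Q_mem_NMinus hψN z, hasLeftLogDerivAt_conj_Q c hψ hz⟩, ?_⟩
  have h := (tendsto_conj_lieExp_w₀ hγ hψN).comp tendsto_neg_log_re
  refine h.congr fun z => ?_
  rw [Function.comp_apply, ← Q_inv_eq, inv_inv]

theorem IsTodaSolution.congr {c : ChevalleyBasis H} {Φ Φ' : ℂ → G}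
    (h : IsTodaSolution b c γ Φ) (he : Set.EqOn Φ' Φ Complex.slitPlane) :
    IsTodaSolution b c γ Φ' := by
  refine ⟨fun z hz => ⟨?_, ?_⟩, ?_⟩
  · rw [he hz]
    exact (h.1 z hz).1
  · exact (h.1 z hz).2.congr (he.eventuallyEq_of_mem (Complex.isOpen_slitPlane.mem_nhds hz))
  · exact h.2.congr' (he.symm.eventuallyEq_of_mem self_mem_nhdsWithin)

end Solution

end TodaLie

end
theorem proposition2p1 {E : Type*} [NormedAddCommGroup E] [NormedSpace ℂ E]
    [FiniteDimensional ℂ E] [CompleteSpace E]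
    {G : Type*} [TopologicalSpace G] [T2Space G] [ConnectedSpace G] [ChartedSpace E G] [Group G]
    [LieGroup 𝓘(ℂ, E) ω G]
    [LieAlgebra.IsSimple ℂ (TodaLie.LieAlg (E := E) G)]
    (H : LieSubalgebra ℂ (TodaLie.LieAlg (E := E) G)) [H.IsCartanSubalgebra]
    (b : (LieAlgebra.IsKilling.rootSystem H).Base)
    (c : TodaLie.ChevalleyBasis H)
    (γ : b.support → ℝ) (hγ : ∀ i, -1 < γ i) :
    ∃ Φ : ℂ → G,
      (∀ Ψ : ℂ → G, TodaLie.IsConjugator b c γ Ψ ↔ Set.EqOn Ψ Φ Complex.slitPlane) ∧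
      (∀ Φ' : ℂ → G, TodaLie.IsTodaSolution b c γ Φ' ↔ Set.EqOn Φ' Φ Complex.slitPlane) ∧
      ∃ ψ : G,
        (∀ g : G, (g ∈ TodaLie.NMinus b ∧
            TodaLie.Ad g⁻¹ (TodaLie.w₀ b γ : TodaLie.LieAlg (E := E) G) =
              (TodaLie.w₀ b γ : TodaLie.LieAlg (E := E) G) - TodaLie.principalF b c) ↔ g = ψ) ∧
        ∀ z ∈ Complex.slitPlane, Φ z = (TodaLie.Q b γ z)⁻¹ * ψ * TodaLie.Q b γ z := by
  obtain ⟨ψ₀, hψ₀N, hψ₀⟩ := TodaLie.exists_Ad_w₀_add_eq hγ (Y := -TodaLie.principalF b c)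
    (neg_mem (TodaLie.principalF_mem_nMinus c))
  obtain ⟨ψ, hψN, hψ⟩ : ∃ ψ ∈ TodaLie.NMinus b,
      TodaLie.Ad ψ⁻¹ (TodaLie.w₀ b γ : TodaLie.LieAlg (E := E) G) =
        (TodaLie.w₀ b γ : TodaLie.LieAlg (E := E) G) - TodaLie.principalF b c := by
    refine ⟨ψ₀, hψ₀N, ?_⟩
    conv_lhs => rw [← hψ₀]
    rw [TodaLie.Ad_inv_apply_Ad, sub_eq_add_neg]
  have hconj := TodaLie.isConjugator_conj_Q hψN hψ
  have hsol := TodaLie.isTodaSolution_conj_Q hγ hψN hψ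
  refine ⟨fun z => (TodaLie.Q b γ z)⁻¹ * ψ * TodaLie.Q b γ z, fun Ψ => ⟨?_, ?_⟩,
    fun Φ' => ⟨hsol.eqOn, hsol.congr⟩, ψ, fun g => ⟨?_, ?_⟩, fun z _ => rfl⟩
  · exact fun h z hz => TodaLie.eq_of_Ad_inv_w₀_eq hγ (h z hz).1 (hconj z hz).1
      ((h z hz).2.trans (hconj z hz).2.symm)
  · intro h z hz
    rw [h hz]
    exact hconj z hz
  · exact fun h => TodaLie.eq_of_Ad_inv_w₀_eq hγ h.1 hψN (h.2.trans hψ.symm)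
  · rintro rfl
    exact ⟨hψN, hψ⟩
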